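/- **Setting.** Let $T=(V,E)$ be a finite tree in which every edge $e$ has a length $\ell_e>0$ and is identified with the interval $[0,\ell_e]$. A *point* is a node of $T$ or a point along an edge, and $\operatorname{dist}$ is the induced path metric on points. There are $k$ mediators; mediator $d_i$ represents $n_i$ agents, and $n=\sum_{i=1}^k n_i\ge 1$. Agent $j$ of $d_i$ has a private location $t_{i,j}$, a point. If the facility is at $x$, the cost of this agent is $\operatorname{dist}(x,t_{i,j})$, the cost of $d_i$ is $\sum_j \operatorname{dist}(x,t_{i,j})$, and the social cost is $\sum_{i,j}\operatorname{dist}(x,t_{i,j})$; for a random facility, expected costs are used. In a randomized direct revelation mechanism each agent tells her mediator a point, each mediator, given the messages of his agents, reports one point per agent to the center, and the center maps these reports to a probability distribution over points. The mechanism is *agent-side incentive compatible* if for every $i$, when $d_i$ reports the messages of his agents truthfully, telling the true location minimizes the expected cost of each agent of $d_i$, whatever all other agents say and whatever strategies the other mediators use. It is *mediator-side incentive compatible* if for every $i$, when all agents of $d_i$ are truthful, reporting truthfully minimizes the expected cost of $d_i$, whatever the other agents say and whatever strategies the other mediators use. It is *two-sided incentive compatible* if it is both. It has *competitive ratio* $\alpha$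 if, when all players are truthful, the expected social cost is always at most $\alpha$ times the minimum social cost over all points. A point $p$ is a *weighted median* of a finite multiset $S$ of weighted points if every sub-multiset of points of $S$ different from $p$, any two of which are connected by a path that does not go through $p$, has weight at most half of the total weight of $S$. A *median* of a multiset of points is a weighted median for unit weights. **The Tree Randomized Mechanism (TRM).** Fix a point $z$ independently of the reports. Let $\ell_i$ be the median closest to $z$ of the points reported by $d_i$, let $\operatorname{size}(p)=\sum_{i:\ell_i=p}n_i$, and let $r$ be the weighted median closest to $z$ of $\{(p,\operatorname{size}(p)) : \operatorname{size}(p)>0\}$. Split edges of $T$ so that $r$ and all $\ell_i$ become nodes, let $V'$ be the resulting set of nodes, and root the tree at $r$. Let $\operatorname{treesize}(u)$ be the sum of $\operatorname{size}(v)$ over the nodes $v$ in the subtree of $u$ (including $u$), let $X=\{u\in V' : \operatorname{treesize}(u)\ge n/4\}$, $c(r)=n/2$, and $c(u)=n/4$ for $u\in X\setminus\{r\}$. The facility is located at $u\in X$ with probability $$p(u)=\frac{\operatorname{treesize}(u)-c(u)}{n/2}-\frac{\sum_{u'\in X\cap\operatorname{children}(u)}\bigl(\operatorname{treesize}(u')-c(u')\bigr)}{n/2},$$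 and $p(u)=0$ for every point $u\notin X$. **Theorem.** For every such tree $T$, every point $z$ and all numbers $n_1,\dots,n_k$ with $n\ge1$, TRM is a randomized mechanism (for all reports, $p$ is a probability distribution), it is two-sided incentive compatible, and it has competitive ratio $2$. -/

import Mathlib

noncomputable section

open scoped Classical

/-- A finite tree with positive edge lengths. -/
structure MetricTree (V : Type*) where
  graph : SimpleGraph V
  isTree : graph.IsTree
  len : Sym2 V → ℝ
  len_pos : ∀ e ∈ graph.edgeSet, 0 < len e

namespace MetricTree

variable {V : Type*} [Fintype V]

/-- A point of the metric tree: a node, or a point along an edge, given by barycentric coordinates.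
The point at distance `x ∈ [0, len e]` from `u` along the edge `e = uv` has coordinate `1 - x / len e`
at `u`, coordinate `x / len e` at `v`, and `0` at all other nodes. -/
@[ext]
structure Point (T : MetricTree V) where
  coord : V → ℝ
  nonneg : ∀ w, 0 ≤ coord w
  sum_eq_one : ∑ w, coord w = 1
  supported : (∃ u, ∀ w, w ≠ u → coord w = 0) ∨
    ∃ u v, T.graph.Adj u v ∧ ∀ w, w ≠ u → w ≠ v → coord w = 0

variable (T : MetricTree V)

/-- A node of the tree, as a point. -/
def node (v : V) : T.Point where
  coord w := if w = v then 1 else 0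
  nonneg w := by split_ifs <;> norm_num
  sum_eq_one := by simp
  supported := Or.inl ⟨v, fun w hw => by simp [hw]⟩

variable {T}

/-- The point `p` lies on the closed edge (or potential edge) between `u` and `v`. -/
def Point.OnEdge (p : T.Point) (u v : V) : Prop :=
  ∀ w, w ≠ u → w ≠ v → p.coord w = 0

/-- `Route p q L`: one can travel from `p` to `q` by finitely many straight moves, each within one
edge, of total length `L`. -/
inductive Route : T.Point → T.Point → ℝ → Prop
  | nil (p : T.Point) : Route p p 0
  | cons {p q r : T.Point} {u v : V} {L : ℝ} (huv : T.graph.Adj u v)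
      (hp : p.OnEdge u v) (hq : q.OnEdge u v) (h : Route q r L) :
      Route p r (T.len s(u, v) * |p.coord u - q.coord u| + L)

/-- The distance along the tree: the length of a shortest route. -/
def treeDist (p q : T.Point) : ℝ := sInf {L | Route p q L}

/-- The path connecting `q` and `q'` goes through `p`. -/
def OnPath (q q' p : T.Point) : Prop :=
  treeDist q p + treeDist p q' = treeDist q q'

/-! ### Weighted medians -/

/-- The total weight of a multiset of weighted points. -/
def weight (S : Multiset (T.Point × ℝ)) : ℝ := (S.map Prod.snd).sum

/-- `p` is a weighted median of `S`: every sub-multiset of weighted points of `S` located off `p`, any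
two of which are connected by a path that avoids `p`, has weight at most half the weight of `S`. -/
def IsWeightedMedian (S : Multiset (T.Point × ℝ)) (p : T.Point) : Prop :=
  ∀ S' ≤ S.filter (fun a => a.1 ≠ p),
    (∀ a ∈ S', ∀ b ∈ S', ¬ OnPath a.1 b.1 p) → weight S' ≤ weight S / 2

/-- `p` is a weighted median of `S` that is closest to `z` among all weighted medians of `S`. -/
def IsClosestWeightedMedian (S : Multiset (T.Point × ℝ)) (z p : T.Point) : Prop :=
  IsWeightedMedian S p ∧ ∀ q, IsWeightedMedian S q → treeDist p z ≤ treeDist q z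

/-- The weighted median of `S` closest to `z`. -/
def closestWeightedMedian (S : Multiset (T.Point × ℝ)) (z : T.Point) : T.Point :=
  if h : ∃ p, IsClosestWeightedMedian S z p then h.choose else z

/-- The median, closest to `z`, of the multiset of the points `t j`. -/
def closestMedian {m : ℕ} (t : Fin m → T.Point) (z : T.Point) : T.Point :=
  closestWeightedMedian (Finset.univ.val.map fun j => (t j, (1 : ℝ))) z

/-! ### Mechanisms for `k` mediators, the `i`-th of which represents `n i` agents -/

variable {k : ℕ} (n : Fin k → ℕ)

variable (T) in
/-- One point for every agent. -/
abbrev Profile : Type _ := ∀ i, Fin (n i) → T.Point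

variable (T) in
/-- A strategy for every mediator: what he reports as a function of what his agents tell him. -/
abbrev MediatorStrategies : Type _ := ∀ i, (Fin (n i) → T.Point) → (Fin (n i) → T.Point)

variable (T) in
/-- A randomized direct revelation mechanism maps the mediators' reports to a distribution of the
location of the facility. -/
abbrev RandomizedMechanism : Type _ := Profile T n → PMF T.Point

/-- The expectation of `cost` under `μ`. (All costs below are bounded functions.) -/
def expectedCost (μ : PMF T.Point) (cost : T.Point → ℝ) : ℝ :=
  ∑' x, (μ x).toReal * cost x

variable {n}

/-- What the center receives if the agents tell their mediators `a` and the mediators play `s`. -/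
def forward (s : MediatorStrategies T n) (a : Profile T n) : Profile T n :=
  fun i => s i (a i)

/-- Agent `j` of mediator `i` changes her message to `t`. -/
def setMessage (a : Profile T n) (i : Fin k) (j : Fin (n i)) (t : T.Point) : Profile T n :=
  Function.update a i (Function.update (a i) j t)

/-- If mediator `i` is truthful, then for each of his agents, telling her true location `t` is a dominant
strategy. -/
def AgentSideIC (M : RandomizedMechanism T n) : Prop :=
  ∀ (i : Fin k) (s : MediatorStrategies T n), s i = id →
    ∀ (a : Profile T n) (j : Fin (n i)) (t t' : T.Point),
      expectedCost (M (forward s (setMessage a i j t))) (fun x => treeDist x t) ≤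
        expectedCost (M (forward s (setMessage a i j t'))) (fun x => treeDist x t)

/-- If all agents of mediator `i` are truthful (their true locations are `a i`), then truthful reporting
is a dominant strategy for mediator `i`. -/
def MediatorSideIC (M : RandomizedMechanism T n) : Prop :=
  ∀ (i : Fin k) (a : Profile T n) (s : MediatorStrategies T n),
    expectedCost (M (forward (Function.update s i id) a)) (fun x => ∑ j, treeDist x (a i j)) ≤
      expectedCost (M (forward s a)) (fun x => ∑ j, treeDist x (a i j))

def TwoSidedIC (M : RandomizedMechanism T n) : Prop :=
  AgentSideIC M ∧ MediatorSideIC M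

/-- The social cost of locating the facility at `x` when the agents are located at `t`. -/
def socialCost (t : Profile T n) (x : T.Point) : ℝ :=
  ∑ i, ∑ j, treeDist x (t i j)

/-- When all players are truthful, the expected social cost is at most `α` times the social cost of
every location. -/
def IsCompetitive (α : ℝ) (M : RandomizedMechanism T n) : Prop :=
  ∀ (t : Profile T n) (q : T.Point), expectedCost (M t) (socialCost t) ≤ α * socialCost t q

/-! ### The Tree Randomized Mechanism, with reports `R` and tie-breaking point `z` -/

namespace TRM

variable (z : T.Point) (R : Profile T n)

/-- The median, closest to `z`, of the points reported by mediator `i`. -/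
def ell (i : Fin k) : T.Point := closestMedian (R i) z

def size (p : T.Point) : ℝ := ∑ i with ell z R i = p, (n i : ℝ)

/-- The multiset of the weighted points `(p, size p)` with `size p > 0`. -/
def L : Multiset (T.Point × ℝ) :=
  ((Finset.univ.image (ell z R)).filter fun p => 0 < size z R p).val.map fun p => (p, size z R p)

def root : T.Point := closestWeightedMedian (L z R) z

/-- The nodes of the tree after its edges have been split at the root and at the medians. -/
def nodes : Finset T.Point :=
  Finset.univ.image T.node ∪ insert (root z R) (Finset.univ.image (ell z R))

/-- Adjacency in the split tree: the path from `u` to `v` goes through no other node. -/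
def Adjacent (u v : T.Point) : Prop :=
  u ≠ v ∧ ∀ w ∈ nodes z R, OnPath u v w → w = u ∨ w = v

/-- The children of `u` in the split tree, rooted at `root`. -/
def children (u : T.Point) : Finset T.Point :=
  (nodes z R).filter fun v => Adjacent z R u v ∧ OnPath (root z R) v u

/-- The nodes in the subtree of `u`, including `u` itself. -/
def subtree (u : T.Point) : Finset T.Point :=
  (nodes z R).filter fun v => OnPath (root z R) v u

def treesize (u : T.Point) : ℝ := ∑ v ∈ subtree z R u, size z R v

variable (n) in
/-- The total number of agents. -/
def total : ℝ := ∑ i, (n i : ℝ)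

def X : Finset T.Point := (nodes z R).filter fun u => total n / 4 ≤ treesize z R u

def c (u : T.Point) : ℝ := if u = root z R then total n / 2 else total n / 4

/-- The probability that the facility is located at `u`. -/
def prob (u : T.Point) : ℝ :=
  if u ∈ X z R then
    (treesize z R u - c z R u) / (total n / 2) -
      (∑ u' ∈ X z R ∩ children z R u, (treesize z R u' - c z R u')) / (total n / 2)
  else 0

/-- `M` is the Tree Randomized Mechanism with tie-breaking point `z`. -/
def IsTRM (z : T.Point) (M : RandomizedMechanism T n) : Prop :=
  ∀ (R : Profile T n) (u : T.Point), (M R u).toReal = prob z R u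

end TRM

end MetricTree

end

set_option linter.unusedSectionVars false

noncomputable section

open scoped Classical

namespace MetricTree

variable {V : Type*} [Fintype V] {T : MetricTree V}

/-! ### Cut coordinates -/

/-! An edge `e` and a number `s` in `[0, 1)` cut the tree into the points that project beyond `s` on
`e` and the rest. The distance of two points is the integral over all cuts, weighted by edge length,
of the indicator that the cut separates them (`treeDist_eq`, `sum_mul_treeDist`). Hence an
inequality between expected costs follows once it holds on every single cut (`sum_mul_treeDist_le`).

On one cut the mechanism is a vote. A mediator's closest median lies beyond the cut iff most of his
reports do, a tie being decided by the side of `z` (`lt_proj_closestMedian_iff`). If mediators with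
a fraction `w` of all agents have their medians beyond, the facility is beyond with probability
`ramp w`, which is `2w - 1/2` clipped to `[0, 1]` (`sum_prob_beyond`): the nodes on the side away
from the root form a subtree, over which the probabilities telescope.

Incentives: majorities and `ramp` are monotone, so by lying an agent can only push probability away
from her side. If `b` of a mediator's `m` agents are beyond, his expected cost on the cut is `b + (m
- 2b) * ramp w`, so he wants `ramp w` large when his majority is beyond and small when it is not,
which is how his truthful median votes.

Ratio: if a fraction `b` of all agents is beyond, then `w ≤ 2b` and `1 - w ≤ 2(1 - b)`, since every
median has at least half of its mediator's agents on its side. This gives `b + (1 - 2b) * ramp w ≤ 2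
* min b (1 - b)` (`one_sub_two_mul_mul_ramp_le`). -/

variable (T) in
/-- The edges of the tree. -/
abbrev Edge : Type _ := T.graph.edgeSet

namespace Edge

/-- One end of an edge. -/
def tail (e : T.Edge) : V := e.1.out.1

/-- The other end of an edge. -/
def head (e : T.Edge) : V := e.1.out.2

lemma mk_tail_head (e : T.Edge) : s(e.tail, e.head) = e.1 := Quot.out_eq e.1

lemma adj (e : T.Edge) : T.graph.Adj e.tail e.head := by
  rw [← SimpleGraph.mem_edgeSet, mk_tail_head]
  exact e.2

/-- The side of the edge `e` on which a node lies: `0` at the tail, and `1` at the head. -/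
def side (e : T.Edge) (w : V) : ℝ :=
  if (T.graph.deleteEdges {e.1}).Reachable e.head w then 1 else 0

lemma side_eq_zero_or_one (e : T.Edge) (w : V) : e.side w = 0 ∨ e.side w = 1 := by
  unfold side; split_ifs <;> simp

lemma side_head (e : T.Edge) : e.side e.head = 1 := by simp [side]

/-- Every edge of an acyclic graph is a bridge. -/
lemma side_tail (e : T.Edge) : e.side e.tail = 0 := by
  have h := SimpleGraph.isAcyclic_iff_forall_isBridge.1 T.isTree.isAcyclic e.2
  rw [← mk_tail_head, SimpleGraph.isBridge_iff] at h
  have : ¬ (T.graph.deleteEdges {e.1}).Reachable e.head e.tail := fun h' => by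
    rw [← mk_tail_head] at h'
    exact h h'.symm
  simp [side, this]

lemma adj_delete (e : T.Edge) {x y : V} (h : T.graph.Adj x y) (hne : s(x, y) ≠ e.1) :
    (T.graph.deleteEdges {e.1}).Adj x y := by
  rw [SimpleGraph.deleteEdges_adj]; exact ⟨h, by simpa using hne⟩

lemma side_eq_of_reachable (e : T.Edge) {x y : V}
    (h : (T.graph.deleteEdges {e.1}).Reachable x y) : e.side x = e.side y := by
  have : (T.graph.deleteEdges {e.1}).Reachable e.head x ↔
      (T.graph.deleteEdges {e.1}).Reachable e.head y :=
    ⟨fun h' => h'.trans h, fun h' => h'.trans h.symm⟩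
  simp [side, this]

lemma side_eq_of_adj (e : T.Edge) {x y : V} (h : T.graph.Adj x y) (hne : s(x, y) ≠ e.1) :
    e.side x = e.side y :=
  e.side_eq_of_reachable (e.adj_delete h hne).reachable

/-- A walk from `w` to the tail either avoids `e` or is at an end of `e` when it first uses it. -/
lemma reachable_tail_or_head (e : T.Edge) (w : V) :
    (T.graph.deleteEdges {e.1}).Reachable e.tail w ∨
      (T.graph.deleteEdges {e.1}).Reachable e.head w := by
  obtain ⟨p⟩ := T.isTree.connected.preconnected w e.tail
  generalize hv : e.tail = v at p
  induction p with
  | nil => left; exact hv ▸ SimpleGraph.Reachable.refl _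
  | @cons x y v hxy p ih =>
    by_cases hne : s(x, y) = e.1
    · have hx : x ∈ s(e.tail, e.head) := by rw [mk_tail_head, ← hne]; simp
      rcases Sym2.mem_iff.1 hx with rfl | rfl
      · left; rw [hv]
      · right; exact SimpleGraph.Reachable.refl _
    · have hr := (e.adj_delete hxy hne).symm.reachable
      subst hv
      exact (ih rfl).imp (·.trans hr) (·.trans hr)

lemma reachable_of_side_eq (e : T.Edge) {x y : V} (h : e.side x = e.side y) :
    (T.graph.deleteEdges {e.1}).Reachable x y := by
  have key : ∀ w, (e.side w = 0 → (T.graph.deleteEdges {e.1}).Reachable e.tail w) ∧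
      (e.side w = 1 → (T.graph.deleteEdges {e.1}).Reachable e.head w) := by
    intro w
    rcases e.reachable_tail_or_head w with hw | hw
    · have := e.side_eq_of_reachable hw
      rw [side_tail] at this
      exact ⟨fun _ => hw, fun h => by simp [h] at this⟩
    · have := e.side_eq_of_reachable hw
      rw [side_head] at this
      exact ⟨fun h => by simp [h] at this, fun _ => hw⟩
  rcases e.side_eq_zero_or_one x with hx | hx
  · exact ((key x).1 hx).symm.trans ((key y).1 (h ▸ hx))
  · exact ((key x).2 hx).symm.trans ((key y).2 (h ▸ hx))

lemma side_tail_eq_side_head {e f : T.Edge} (hef : e ≠ f) : f.side e.tail = f.side e.head :=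
  f.side_eq_of_adj e.adj fun h => hef (Subtype.ext (e.mk_tail_head ▸ h))

/-- Nodes separated by `f` from the edge `e` all lie on the same side of `e`. -/
lemma side_eq_of_side_ne {e f : T.Edge} (hef : e ≠ f) {x y : V}
    (hx : f.side x ≠ f.side e.tail) (hy : f.side y ≠ f.side e.tail) : e.side x = e.side y := by
  have hxy : f.side x = f.side y := by
    rcases f.side_eq_zero_or_one x with h1 | h1 <;> rcases f.side_eq_zero_or_one y with h2 | h2 <;>
    rcases f.side_eq_zero_or_one e.tail with h3 | h3 <;> simp_all
  -- A walk that avoids `f` stays on the side of `f` away from `e`, so it never uses `e`.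
  obtain ⟨p⟩ := f.reachable_of_side_eq hxy
  clear hxy hy
  induction p with
  | nil => rfl
  | @cons x x' y h p ih =>
    have hr := f.side_eq_of_reachable h.reachable
    rw [← ih (hr ▸ hx)]
    rw [SimpleGraph.deleteEdges_adj] at h
    refine e.side_eq_of_adj h.1 fun he => ?_
    have hx' : x ∈ s(e.tail, e.head) := by rw [mk_tail_head, ← he]; simp
    rcases Sym2.mem_iff.1 hx' with rfl | rfl
    · exact hx rfl
    · exact hx (side_tail_eq_side_head hef).symm

/-- Any two nodes are separated by an edge at the first of them. -/
lemma exists_side_ne {x y : V} (hxy : x ≠ y) :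
    ∃ e : T.Edge, (x = e.tail ∨ x = e.head) ∧ e.side x ≠ e.side y := by
  obtain ⟨p, hp⟩ := T.isTree.connected.exists_isPath x y
  cases p with
  | nil => exact absurd rfl hxy
  | @cons _ x' _ h p =>
    rw [SimpleGraph.Walk.cons_isPath_iff] at hp
    let e : T.Edge := ⟨s(x, x'), h⟩
    have hx : x ∈ s(e.tail, e.head) := by rw [mk_tail_head]; simp [e]
    have hx' : x' ∈ s(e.tail, e.head) := by rw [mk_tail_head]; simp [e]
    have hr : e.side x' = e.side y := by
      -- The rest of the path does not return to `x`, hence avoids `e`.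
      refine e.side_eq_of_reachable ⟨p.toDeleteEdge e.1 fun hm => ?_⟩
      exact hp.2 (SimpleGraph.Walk.fst_mem_support_of_mem_edges p hm)
    refine ⟨e, Sym2.mem_iff.1 hx, ?_⟩
    rw [← hr]
    have hne := h.ne
    rcases Sym2.mem_iff.1 hx with h1 | h1 <;> rcases Sym2.mem_iff.1 hx' with h2 | h2
    · exact absurd (h1.trans h2.symm) hne
    · rw [h1, h2, side_tail, side_head]; norm_num
    · rw [h1, h2, side_tail, side_head]; norm_num
    · exact absurd (h1.trans h2.symm) hne

/-- The projection of a point to the edge `e ≅ [0, 1]`. -/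
def proj (e : T.Edge) (p : T.Point) : ℝ := ∑ w, p.coord w * e.side w

lemma proj_node (e : T.Edge) (v : V) : e.proj (T.node v) = e.side v := by
  simp [proj, node]

lemma side_nonneg (e : T.Edge) (w : V) : 0 ≤ e.side w := by
  rcases e.side_eq_zero_or_one w with h | h <;> simp [h]

lemma side_le_one (e : T.Edge) (w : V) : e.side w ≤ 1 := by
  rcases e.side_eq_zero_or_one w with h | h <;> simp [h]

lemma proj_nonneg (e : T.Edge) (p : T.Point) : 0 ≤ e.proj p :=
  Finset.sum_nonneg fun w _ => mul_nonneg (p.nonneg w) (e.side_nonneg w)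

lemma proj_le_one (e : T.Edge) (p : T.Point) : e.proj p ≤ 1 := by
  rw [← p.sum_eq_one]
  exact Finset.sum_le_sum fun w _ => mul_le_of_le_one_right (p.nonneg w) (e.side_le_one w)

/-- The point `p` lies on the edge `e`. -/
def Contains (e : T.Edge) (p : T.Point) : Prop := p.OnEdge e.tail e.head

end Edge

namespace Point

lemma OnEdge.symm {p : T.Point} {u v : V} (h : p.OnEdge u v) : p.OnEdge v u :=
  fun w h1 h2 => h w h2 h1

lemma OnEdge.sum_eq {p : T.Point} {u v : V} (huv : u ≠ v) (h : p.OnEdge u v) (g : V → ℝ) :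
    ∑ w, p.coord w * g w = p.coord u * g u + p.coord v * g v := by
  rw [← Finset.sum_pair (f := fun w => p.coord w * g w) huv]
  symm
  refine Finset.sum_subset (Finset.subset_univ _) fun w _ hw => ?_
  simp only [Finset.mem_insert, Finset.mem_singleton, not_or] at hw
  simp [h w hw.1 hw.2]

lemma OnEdge.coord_add {p : T.Point} {u v : V} (huv : u ≠ v) (h : p.OnEdge u v) :
    p.coord u + p.coord v = 1 := by
  have := h.sum_eq huv 1
  simp only [Pi.one_apply, mul_one, p.sum_eq_one] at this
  exact this.symm

lemma exists_eq_node_or_onEdge (p : T.Point) :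
    (∃ v, p = T.node v) ∨ ∃ u v, T.graph.Adj u v ∧ p.OnEdge u v := by
  refine p.supported.imp (fun ⟨u, hu⟩ => ⟨u, ?_⟩) id
  have h1 : p.coord u = 1 := by
    rw [← p.sum_eq_one, Finset.sum_eq_single u (fun w _ hw => hu w hw) (by simp)]
  ext w
  by_cases hw : w = u
  · subst hw; simp [node, h1]
  · simp [node, hw, hu w hw]

end Point

namespace Edge

lemma Contains.proj_eq {e : T.Edge} {p : T.Point} (h : e.Contains p) :
    e.proj p = p.coord e.head := by
  rw [proj, Point.OnEdge.sum_eq e.adj.ne h, side_tail, side_head]; ring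

lemma Contains.coord_add {e : T.Edge} {p : T.Point} (h : e.Contains p) :
    p.coord e.tail + p.coord e.head = 1 := Point.OnEdge.coord_add e.adj.ne h

lemma Contains.ext {e : T.Edge} {p q : T.Point} (hp : e.Contains p) (hq : e.Contains q)
    (h : e.proj p = e.proj q) : p = q := by
  rw [hp.proj_eq, hq.proj_eq] at h
  have h1 := hp.coord_add
  have h2 := hq.coord_add
  ext w
  by_cases hw : w = e.head
  · rw [hw, h]
  · by_cases hw' : w = e.tail
    · rw [hw']; linarith
    · rw [hp w hw' hw, hq w hw' hw]

lemma contains_tail (e : T.Edge) : e.Contains (T.node e.tail) := fun w h _ => by simp [node, h]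

lemma contains_head (e : T.Edge) : e.Contains (T.node e.head) := fun w _ h => by simp [node, h]

lemma proj_eq_side_of_onEdge (f : T.Edge) {p : T.Point} {u v : V} (huv : T.graph.Adj u v)
    (h : p.OnEdge u v) (hne : s(u, v) ≠ f.1) : f.proj p = f.side u := by
  rw [proj, h.sum_eq huv.ne, ← f.side_eq_of_adj huv hne, ← add_mul, h.coord_add huv.ne, one_mul]

lemma Contains.proj_eq_side {e f : T.Edge} (hef : e ≠ f) {p : T.Point} (h : e.Contains p) :
    f.proj p = f.side e.tail :=
  f.proj_eq_side_of_onEdge e.adj h fun h => hef (Subtype.ext (e.mk_tail_head ▸ h))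

lemma contains_of_onEdge {e : T.Edge} {p : T.Point} {u v : V} (h : p.OnEdge u v)
    (he : s(u, v) = e.1) : e.Contains p := by
  rw [← mk_tail_head, Sym2.eq_iff] at he
  rcases he with ⟨rfl, rfl⟩ | ⟨rfl, rfl⟩
  · exact h
  · exact h.symm

/-- A point off `e` is a node or lies on another edge, both ends of which are on the same side of
`e`. -/
lemma contains_or_proj_eq (e : T.Edge) (p : T.Point) :
    e.Contains p ∨ e.proj p = 0 ∨ e.proj p = 1 := by
  rcases p.exists_eq_node_or_onEdge with ⟨v, rfl⟩ | ⟨u, v, huv, h⟩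
  · right; rw [proj_node]; exact e.side_eq_zero_or_one v
  · by_cases he : s(u, v) = e.1
    · exact .inl (contains_of_onEdge h he)
    · right; rw [e.proj_eq_side_of_onEdge huv h he]; exact e.side_eq_zero_or_one u

/-- Points separated by `f` from the edge `e` all have the same projection to `e`. -/
lemma proj_eq_of_proj_ne {e f : T.Edge} (hef : e ≠ f) {a b : T.Point}
    (ha : f.proj a ≠ f.side e.tail) (hb : f.proj b ≠ f.side e.tail) : e.proj a = e.proj b := by
  -- Reduces to nodes: such a point shares its projection to `e` with a node that is also behind
  -- `f`.
  have key : ∀ a : T.Point, f.proj a ≠ f.side e.tail →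
      ∃ x, f.side x ≠ f.side e.tail ∧ e.proj a = e.side x := by
    intro a ha
    rcases a.exists_eq_node_or_onEdge with ⟨v, rfl⟩ | ⟨u, v, huv, h⟩
    · exact ⟨v, by rwa [proj_node] at ha, e.proj_node v⟩
    · by_cases he : s(u, v) = e.1
      · exact absurd ((contains_of_onEdge h he).proj_eq_side hef) ha
      · by_cases hu : f.side u = f.side e.tail
        · refine ⟨v, fun hv => ha ?_, ?_⟩
          · rw [proj, h.sum_eq huv.ne, hu, hv, ← add_mul, h.coord_add huv.ne, one_mul]
          · rw [e.proj_eq_side_of_onEdge huv h he, e.side_eq_of_adj huv he]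
        · exact ⟨u, hu, e.proj_eq_side_of_onEdge huv h he⟩
  obtain ⟨x, hx, hax⟩ := key a ha
  obtain ⟨y, hy, hby⟩ := key b hb
  rw [hax, hby, side_eq_of_side_ne hef hx hy]

/-- If a point of the edge `e` is between `a` and `b` in the coordinate `e`, and `e` tells `a` and `b`
apart, then it is between them in every coordinate. -/
lemma Contains.proj_mem_uIcc {e : T.Edge} {y a b : T.Point} (hy : e.Contains y)
    (h : e.proj y ∈ Set.uIcc (e.proj a) (e.proj b)) (hab : e.proj a ≠ e.proj b) (f : T.Edge) :
    f.proj y ∈ Set.uIcc (f.proj a) (f.proj b) := by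
  by_cases hef : e = f
  · exact hef ▸ h
  rw [hy.proj_eq_side hef]
  -- All of `e` projects to one end of `f`. If neither `a` nor `b` projects there, both are behind
  -- `f`, and `e` cannot tell them apart.
  by_cases ha : f.proj a = f.side e.tail
  · rw [ha]; exact Set.left_mem_uIcc
  · by_cases hb : f.proj b = f.side e.tail
    · rw [hb]; exact Set.right_mem_uIcc
    · exact absurd (proj_eq_of_proj_ne hef ha hb) hab

end Edge

/-- Distinct points are separated by an edge that contains the first of them. -/
lemma exists_contains_proj_ne {p q : T.Point} (hpq : p ≠ q) :
    ∃ e : T.Edge, e.Contains p ∧ e.proj p ≠ e.proj q := by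
  have hnode : ∀ x, p = T.node x → ∃ e : T.Edge, e.Contains p ∧ e.proj p ≠ e.proj q := by
    rintro x rfl
    -- An edge at `x` separating `x` from `y` also separates `x` from `q`, because `q` has positive
    -- mass at `y`.
    obtain ⟨y, hyx, hy⟩ : ∃ y, y ≠ x ∧ q.coord y ≠ 0 := by
      by_contra! hcon
      refine hpq ?_
      have h1 : q.coord x = 1 := by
        rw [← q.sum_eq_one, Finset.sum_eq_single x (fun w _ hw => hcon w hw) (by simp)]
      ext w
      by_cases hw : w = x
      · subst hw; simp [node, h1]
      · simp [node, hw, hcon w hw]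
    have hy' : 0 < q.coord y := lt_of_le_of_ne (q.nonneg y) (Ne.symm hy)
    obtain ⟨e, hxe, hside⟩ := Edge.exists_side_ne (T := T) hyx.symm
    refine ⟨e, ?_, ?_⟩
    · rcases hxe with rfl | rfl
      · exact e.contains_tail
      · exact e.contains_head
    · rw [Edge.proj_node]
      rcases e.side_eq_zero_or_one x with hx | hx <;> rcases e.side_eq_zero_or_one y with h1 | h1
      · exact absurd (hx.trans h1.symm) hside
      · rw [hx]
        refine ne_of_lt (hy'.trans_le ?_)
        have := Finset.single_le_sum (f := fun w => q.coord w * e.side w)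
          (fun w _ => mul_nonneg (q.nonneg w) (e.side_nonneg w)) (Finset.mem_univ y)
        rw [h1, mul_one] at this
        exact this
      · rw [hx]
        refine ne_of_gt ?_
        rw [Edge.proj, ← q.sum_eq_one]
        refine Finset.sum_lt_sum
          (fun w _ => mul_le_of_le_one_right (q.nonneg w) (e.side_le_one w)) ⟨y, Finset.mem_univ _, ?_⟩
        simpa [h1] using hy'
      · exact absurd (hx.trans h1.symm) hside
  rcases p.exists_eq_node_or_onEdge with ⟨v, hv⟩ | ⟨u, v, huv, h⟩
  · exact hnode v hv
  · let e : T.Edge := ⟨s(u, v), huv⟩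
    have hp : e.Contains p := Edge.contains_of_onEdge h rfl
    by_cases hne : e.proj p = e.proj q
    · rcases e.contains_or_proj_eq q with hq | hq | hq
      · exact absurd (hp.ext hq hne) hpq
      · refine hnode e.tail (hp.ext e.contains_tail ?_)
        rw [hne, hq, Edge.proj_node, Edge.side_tail]
      · refine hnode e.head (hp.ext e.contains_head ?_)
        rw [hne, hq, Edge.proj_node, Edge.side_head]
    · exact ⟨e, hp, hne⟩

/-! ### The distance in cut coordinates -/

/-- The weighted `ℓ¹` distance of the cut coordinates; it equals `treeDist`. -/
def cutDist (p q : T.Point) : ℝ := ∑ e : T.Edge, T.len e.1 * |e.proj p - e.proj q|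

lemma cutDist_triangle (p q r : T.Point) : cutDist p r ≤ cutDist p q + cutDist q r := by
  rw [cutDist, cutDist, cutDist, ← Finset.sum_add_distrib]
  refine Finset.sum_le_sum fun e _ => ?_
  rw [← mul_add]
  exact mul_le_mul_of_nonneg_left (abs_sub_le _ _ _) (T.len_pos e.1 e.2).le

lemma cutDist_eq_of_onEdge {p q : T.Point} {u v : V} (huv : T.graph.Adj u v) (hp : p.OnEdge u v)
    (hq : q.OnEdge u v) : T.len s(u, v) * |p.coord u - q.coord u| = cutDist p q := by
  let e : T.Edge := ⟨s(u, v), huv⟩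
  have hpe : e.Contains p := Edge.contains_of_onEdge hp rfl
  have hqe : e.Contains q := Edge.contains_of_onEdge hq rfl
  rw [cutDist, Finset.sum_eq_single e]
  · rw [hpe.proj_eq, hqe.proj_eq]
    congr 1
    have hu : u ∈ s(e.tail, e.head) := by rw [Edge.mk_tail_head]; simp [e]
    have h1 := hpe.coord_add
    have h2 := hqe.coord_add
    rcases Sym2.mem_iff.1 hu with hu | hu
    · rw [hu, abs_sub_comm]
      congr 1
      linarith
    · rw [hu]
  · intro f _ hf
    rw [hpe.proj_eq_side hf.symm, hqe.proj_eq_side hf.symm]; simp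
  · simp

lemma Route.cutDist_le {p q : T.Point} {L : ℝ} (h : Route p q L) : cutDist p q ≤ L := by
  induction h with
  | nil p => simp [cutDist]
  | @cons p q r u v L huv hp hq _ ih =>
    rw [cutDist_eq_of_onEdge huv hp hq]
    linarith [cutDist_triangle p q r]

/-- Edge lengths are positive, so the sum of the coordinatewise triangle inequalities is tight iff
each of them is. -/
lemma cutDist_add_eq_iff {a p b : T.Point} :
    cutDist a p + cutDist p b = cutDist a b ↔
      ∀ e : T.Edge, e.proj p ∈ Set.uIcc (e.proj a) (e.proj b) := by
  rw [cutDist, cutDist, cutDist, ← Finset.sum_add_distrib, eq_comm, Finset.sum_eq_sum_iff_of_le]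
  · simp only [Finset.mem_univ, true_implies, ← mul_add]
    refine forall_congr' fun e => ?_
    rw [mul_right_inj' (T.len_pos e.1 e.2).ne', Set.mem_uIcc]
    constructor
    · intro h
      by_contra! hcon
      rcases abs_cases (e.proj a - e.proj b) with h1 | h1 <;>
      rcases abs_cases (e.proj a - e.proj p) with h2 | h2 <;>
      rcases abs_cases (e.proj p - e.proj b) with h3 | h3 <;>
      grind
    · rintro (h | h)
      · rw [abs_of_nonpos, abs_of_nonpos, abs_of_nonpos] <;> linarith
      · rw [abs_of_nonneg, abs_of_nonneg, abs_of_nonneg] <;> linarith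
  · intro e _
    rw [← mul_add]
    exact mul_le_mul_of_nonneg_left (abs_sub_le _ _ _) (T.len_pos e.1 e.2).le

/-- Induction on the number of edges whose coordinate differs at `p` and `q`. Moving along an edge
at `p` until its coordinate agrees with that of `q` changes no other coordinate and wastes no
length. -/
lemma exists_route (p q : T.Point) : Route p q (cutDist p q) := by
  induction hm : (Finset.univ.filter fun e : T.Edge => e.proj p ≠ e.proj q).card using
    Nat.strong_induction_on generalizing p with
  | _ m ih =>
  by_cases hpq : p = q
  · subst hpq
    have : cutDist p p = 0 := by simp [cutDist]
    rw [this]; exact Route.nil p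
  obtain ⟨e, hpe, hne⟩ := exists_contains_proj_ne hpq
  have step : ∀ y : T.Point, e.Contains y → e.proj y = e.proj q → Route p q (cutDist p q) := by
    intro y hy hyq
    have hadd : cutDist p y + cutDist y q = cutDist p q :=
      cutDist_add_eq_iff.2 (hy.proj_mem_uIcc (by rw [hyq]; exact Set.right_mem_uIcc) hne)
    rw [← hadd, ← cutDist_eq_of_onEdge e.adj hpe hy]
    refine Route.cons e.adj hpe hy (ih _ ?_ y rfl)
    rw [← hm]
    refine Finset.card_lt_card (Finset.ssubset_iff_of_subset ?_ |>.2 ⟨e, ?_, ?_⟩)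
    · intro f hf
      simp only [Finset.mem_filter, Finset.mem_univ, true_and] at hf ⊢
      by_cases hef : e = f
      · exact hef ▸ hne
      · rwa [hpe.proj_eq_side hef, ← hy.proj_eq_side hef]
    · simpa using hne
    · simpa using hyq
  -- The target of the move is `q` itself if it is on `e`, and otherwise an end of `e`.
  rcases e.contains_or_proj_eq q with hq | hq | hq
  · exact step q hq rfl
  · exact step _ e.contains_tail (by rw [hq, Edge.proj_node, Edge.side_tail])
  · exact step _ e.contains_head (by rw [hq, Edge.proj_node, Edge.side_head])

lemma treeDist_eq (p q : T.Point) :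
    treeDist p q = ∑ e : T.Edge, T.len e.1 * |e.proj p - e.proj q| :=
  IsLeast.csInf_eq ⟨exists_route p q, fun _ h => Route.cutDist_le h⟩

lemma onPath_iff {a b p : T.Point} :
    OnPath a b p ↔ ∀ e : T.Edge, e.proj p ∈ Set.uIcc (e.proj a) (e.proj b) := by
  rw [← cutDist_add_eq_iff, OnPath, treeDist_eq, treeDist_eq, treeDist_eq, cutDist, cutDist, cutDist]

lemma treeDist_triangle (p q r : T.Point) : treeDist p r ≤ treeDist p q + treeDist q r := by
  simp only [treeDist_eq]; exact cutDist_triangle p q r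

lemma treeDist_comm (p q : T.Point) : treeDist p q = treeDist q p := by
  simp only [treeDist_eq, abs_sub_comm]

lemma treeDist_self (p : T.Point) : treeDist p p = 0 := by simp [treeDist_eq]

lemma treeDist_nonneg (p q : T.Point) : 0 ≤ treeDist p q := by
  rw [treeDist_eq]
  exact Finset.sum_nonneg fun e _ => mul_nonneg (T.len_pos e.1 e.2).le (abs_nonneg _)

lemma treeDist_pos {p q : T.Point} (h : p ≠ q) : 0 < treeDist p q := by
  obtain ⟨e, -, he⟩ := exists_contains_proj_ne h
  rw [treeDist_eq]
  refine Finset.sum_pos' (fun e _ => mul_nonneg (T.len_pos e.1 e.2).le (abs_nonneg _))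
    ⟨e, Finset.mem_univ _, mul_pos (T.len_pos e.1 e.2) (abs_pos.2 (sub_ne_zero.2 he))⟩

lemma eq_of_treeDist_le_zero {p q : T.Point} (h : treeDist p q ≤ 0) : p = q := by
  by_contra hne
  exact absurd (treeDist_pos hne) h.not_gt

lemma Edge.Contains.onPath {e : T.Edge} {y a b : T.Point} (hy : e.Contains y)
    (h : e.proj y ∈ Set.uIcc (e.proj a) (e.proj b)) (hab : e.proj a ≠ e.proj b) : OnPath a b y :=
  onPath_iff.2 (hy.proj_mem_uIcc h hab)

/-! ### Paths from a fixed point -/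

lemma onPath_left (a b : T.Point) : OnPath a b a := by simp [OnPath, treeDist_self]

lemma onPath_right (a b : T.Point) : OnPath a b b := by simp [OnPath, treeDist_self]

lemma OnPath.trans {r u v w : T.Point} (h1 : OnPath r w v) (h2 : OnPath r v u) : OnPath r w u := by
  unfold OnPath at *
  linarith [treeDist_triangle u v w, treeDist_triangle r u w]

lemma OnPath.trans' {r u v w : T.Point} (h1 : OnPath r w v) (h2 : OnPath r v u) :
    OnPath u w v := by
  unfold OnPath at *
  linarith [treeDist_triangle u v w, treeDist_triangle r u w]

lemma OnPath.antisymm {r u v : T.Point} (h1 : OnPath r v u) (h2 : OnPath r u v) : u = v := by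
  unfold OnPath at *
  refine eq_of_treeDist_le_zero ?_
  linarith [treeDist_comm u v]

lemma OnPath.eq_left {r u : T.Point} (h : OnPath r r u) : u = r :=
  h.antisymm (onPath_left r u)

/-- The points on a path from `r` are linearly ordered. -/
lemma OnPath.total {r u v w : T.Point} (hu : OnPath r w u) (hv : OnPath r w v) :
    OnPath r v u ∨ OnPath r u v := by
  by_contra! hcon
  simp only [onPath_iff, not_forall] at hcon hu hv
  obtain ⟨⟨e, he⟩, ⟨f, hf⟩⟩ := hcon
  have hue := hu e
  have hve := hv e
  have huf := hu f
  have hvf := hv f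
  simp only [Set.mem_uIcc, not_or, not_and_or, not_le] at he hf hue hve huf hvf
  have hef : e ≠ f := by
    rintro rfl
    grind
  -- Going from `r` to `w`, `e` sees `v` strictly before `u`, and `f` sees `u` strictly before `v`.
  -- So `e` distinguishes `r` from `u`, and `v` from `w`. Hence in each of these pairs some point
  -- has the `f`-coordinate of `e`, which contradicts the order seen by `f`.
  have key : ∀ a b, e.proj a ≠ e.proj b → f.proj a = f.side e.tail ∨ f.proj b = f.side e.tail := by
    intro a b hab
    by_contra! h
    exact hab (Edge.proj_eq_of_proj_ne hef h.1 h.2)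
  have k1 := key r u
  have k2 := key v w
  have k3 := key r w
  have k4 := key v u
  grind

/-- Among the points of a finite set containing all nodes, the first one of an edge behind a cut. -/
lemma Edge.exists_next (e : T.Edge) {N : Finset T.Point} (hN : ∀ v, T.node v ∈ N) {s : ℝ}
    (hs : s < 1) : ∃ y ∈ N, e.Contains y ∧ s < e.proj y ∧
      ∀ a ∈ N, s < e.proj a → e.proj y ≤ e.proj a := by
  obtain ⟨y, hy, hmin⟩ := Finset.exists_min_image
    (N.filter fun y => e.Contains y ∧ s < e.proj y) e.proj
    ⟨T.node e.head, by simp [hN, contains_head, proj_node, side_head, hs]⟩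
  simp only [Finset.mem_filter] at hy hmin
  refine ⟨y, hy.1, hy.2.1, hy.2.2, fun a ha hsa => ?_⟩
  rcases e.contains_or_proj_eq a with h | h | h
  · exact hmin a ⟨ha, h, hsa⟩
  · have := hmin (T.node e.tail) ⟨hN _, e.contains_tail, by rw [proj_node, side_tail, ← h]; exact hsa⟩
    rwa [proj_node, side_tail, ← h] at this
  · rw [h]; exact e.proj_le_one y

/-- Among the points of a finite set containing all nodes, the last one of an edge before a cut. -/
lemma Edge.exists_prev (e : T.Edge) {N : Finset T.Point} (hN : ∀ v, T.node v ∈ N) {s : ℝ}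
    (hs : 0 ≤ s) : ∃ y ∈ N, e.Contains y ∧ e.proj y ≤ s ∧
      ∀ a ∈ N, e.proj a ≤ s → e.proj a ≤ e.proj y := by
  obtain ⟨y, hy, hmax⟩ := Finset.exists_max_image
    (N.filter fun y => e.Contains y ∧ e.proj y ≤ s) e.proj
    ⟨T.node e.tail, by simp [hN, contains_tail, proj_node, side_tail, hs]⟩
  simp only [Finset.mem_filter] at hy hmax
  refine ⟨y, hy.1, hy.2.1, hy.2.2, fun a ha hsa => ?_⟩
  rcases e.contains_or_proj_eq a with h | h | h
  · exact hmax a ⟨ha, h, hsa⟩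
  · rw [h]; exact e.proj_nonneg y
  · have := hmax (T.node e.head) ⟨hN _, e.contains_head, by rw [proj_node, side_head, ← h]; exact hsa⟩
    rwa [proj_node, side_head, ← h] at this

/-! ### Weighted medians in cut coordinates -/

lemma weight_nonneg {S : Multiset (T.Point × ℝ)} (hS : ∀ a ∈ S, 0 ≤ a.2) : 0 ≤ weight S :=
  Multiset.sum_nonneg fun x hx => by
    obtain ⟨a, ha, rfl⟩ := Multiset.mem_map.1 hx
    exact hS a ha

lemma weight_add (S S' : Multiset (T.Point × ℝ)) : weight (S + S') = weight S + weight S' := by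
  simp [weight]

lemma weight_mono {S S' : Multiset (T.Point × ℝ)} (hS : ∀ a ∈ S, 0 ≤ a.2) (h : S' ≤ S) :
    weight S' ≤ weight S := by
  obtain ⟨U, rfl⟩ := Multiset.le_iff_exists_add.1 h
  rw [weight_add]
  linarith [weight_nonneg (S := U) fun a ha => hS a (Multiset.mem_add.2 (.inr ha))]

lemma weight_filter_add_not (S : Multiset (T.Point × ℝ)) (P : T.Point × ℝ → Prop)
    [DecidablePred P] : weight (S.filter P) + weight (S.filter fun a => ¬ P a) = weight S := by
  rw [← weight_add, Multiset.filter_add_not]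

/-- The weight of `S` behind the cut of the edge `e` at `s`. -/
def weightBeyond (S : Multiset (T.Point × ℝ)) (e : T.Edge) (s : ℝ) : ℝ :=
  weight (S.filter fun a => s < e.proj a.1)

/-- The weighted majority of `S`, with ties broken in favour of `z`, is behind the cut of `e` at `s`. -/
def MajorityBeyond (S : Multiset (T.Point × ℝ)) (z : T.Point) (e : T.Edge) (s : ℝ) : Prop :=
  weight S / 2 < weightBeyond S e s ∨ weightBeyond S e s = weight S / 2 ∧ s < e.proj z

/-- `r` is on the majority side of every cut. -/
def IsCutMedian (S : Multiset (T.Point × ℝ)) (z r : T.Point) : Prop :=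
  ∀ (e : T.Edge) (s : ℝ), 0 ≤ s → s < 1 → (s < e.proj r ↔ MajorityBeyond S z e s)

/-- The weighted sum of the distances from `x` to the points of `S`. -/
def weightedCost (S : Multiset (T.Point × ℝ)) (x : T.Point) : ℝ :=
  (S.map fun a => a.2 * treeDist x a.1).sum

/-- Moving from `r` to a point `y` that is on the path to each of the weighted points with property
`P` lowers the cost in proportion to the majority of these. -/
lemma weightedCost_le {S : Multiset (T.Point × ℝ)} (hS : ∀ a ∈ S, 0 ≤ a.2) {r y : T.Point}
    {P : T.Point × ℝ → Prop} [DecidablePred P] (hP : ∀ a ∈ S, P a → OnPath r a.1 y) :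
    weightedCost S y ≤
      weightedCost S r + treeDist r y * (weight S - 2 * weight (S.filter P)) := by
  induction S using Multiset.induction with
  | empty => simp [weightedCost, weight]
  | cons a S ih =>
    have ih := ih (fun b hb => hS b (Multiset.mem_cons_of_mem hb))
      (fun b hb => hP b (Multiset.mem_cons_of_mem hb))
    have ha := hS a (Multiset.mem_cons_self a S)
    have hPa := hP a (Multiset.mem_cons_self a S)
    by_cases h : P a
    · have := hPa h
      unfold OnPath at this
      rw [Multiset.filter_cons_of_pos _ h]
      simp only [weightedCost, weight, Multiset.map_cons, Multiset.sum_cons] at ih ⊢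
      rw [← this]
      linarith
    · rw [Multiset.filter_cons_of_neg _ h]
      simp only [weightedCost, weight, Multiset.map_cons, Multiset.sum_cons] at ih ⊢
      have := mul_le_mul_of_nonneg_left (treeDist_triangle y r a.1) ha
      rw [treeDist_comm y r] at this
      linarith

/-- Take a minimizer, over a finite set of candidates, of the weighted cost and then of the distance
to `z`. On the wrong side of a cut, it could be improved by moving to the nearest candidate across
on that edge. -/
lemma exists_isCutMedian {S : Multiset (T.Point × ℝ)} (hS : ∀ a ∈ S, 0 ≤ a.2) (z : T.Point) :
    ∃ r, IsCutMedian S z r := by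
  let N : Finset T.Point := insert z (Finset.univ.image T.node ∪ S.toFinset.image Prod.fst)
  have hN : ∀ v, T.node v ∈ N := fun v => by simp [N]
  have hzN : z ∈ N := by simp [N]
  have hSN : ∀ a ∈ S, a.1 ∈ N := fun a ha => by
    refine Finset.mem_insert_of_mem (Finset.mem_union_right _ ?_)
    exact Finset.mem_image_of_mem _ (Multiset.mem_toFinset.2 ha)
  obtain ⟨r, hrN, hmin⟩ := Finset.exists_min_image N
    (fun x => toLex (weightedCost S x, treeDist x z)) ⟨z, hzN⟩
  have hmin' : ∀ y ∈ N, weightedCost S r < weightedCost S y ∨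
      weightedCost S r = weightedCost S y ∧ treeDist r z ≤ treeDist y z := fun y hy => by
    simpa [Prod.Lex.le_iff] using hmin y hy
  -- If `P` had more than half of the weight, `y` would be cheaper than `r`. If it had exactly half
  -- and included `z`, then `y` would be no dearer and closer to `z`.
  have improve : ∀ y ∈ N, y ≠ r → ∀ (P : T.Point → Prop) [DecidablePred P], (∀ a ∈ N, P a → OnPath r a y) →
      weight (S.filter fun a => P a.1) ≤ weight S / 2 ∧
        (weight (S.filter fun a => P a.1) = weight S / 2 → ¬ P z) := by
    intro y hy hyr P _ hP
    have hpos := treeDist_pos hyr.symm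
    have hle := weightedCost_le (P := fun a => P a.1) hS (fun a ha h => hP a.1 (hSN a ha) h)
    constructor
    · by_contra! hcon
      have : treeDist r y * (weight S - 2 * weight (S.filter fun a => P a.1)) < 0 :=
        mul_neg_of_pos_of_neg hpos (by linarith)
      rcases hmin' y hy with h | ⟨h, -⟩ <;> linarith
    · intro heq hz
      have hpath := hP z hzN hz
      unfold OnPath at hpath
      rw [heq, show weight S - 2 * (weight S / 2) = 0 by ring, mul_zero, add_zero] at hle
      rcases hmin' y hy with h | ⟨-, h⟩ <;> linarith
  refine ⟨r, fun e s hs0 hs1 => ⟨fun hr => ?_, fun hmaj => ?_⟩⟩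
  · obtain ⟨y, hyN, hye, hys, hymax⟩ := e.exists_prev hN hs0
    have hyr : y ≠ r := by rintro rfl; exact absurd hr hys.not_gt
    have := improve y hyN hyr (fun a => ¬ s < e.proj a) fun a ha has => by
      have h1 := hymax a ha (not_lt.1 has)
      exact hye.onPath (Set.mem_uIcc.2 (.inr ⟨h1, by linarith⟩)) (by linarith)
    have hsum := weight_filter_add_not S fun a => s < e.proj a.1
    unfold MajorityBeyond weightBeyond
    by_cases heq : weight (S.filter fun a => s < e.proj a.1) = weight S / 2
    · exact .inr ⟨heq, not_not.1 (this.2 (by linarith))⟩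
    · refine .inl (lt_of_le_of_ne ?_ (Ne.symm heq))
      linarith [this.1]
  · by_contra! hr
    obtain ⟨y, hyN, hye, hys, hymin⟩ := e.exists_next hN hs1
    have hyr : y ≠ r := by rintro rfl; exact absurd hys hr.not_gt
    have := improve y hyN hyr (fun a => s < e.proj a) fun a ha has => by
      have h1 := hymin a ha has
      exact hye.onPath (Set.mem_uIcc.2 (.inl ⟨by linarith, h1⟩)) (by linarith)
    rcases hmaj with h | ⟨h, hz⟩
    · exact absurd this.1 h.not_ge
    · exact this.2 h hz

/-- Take an edge at `r` that separates `r` from one point of `S'`. All of `S'` is on that same side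
of `r`, since otherwise a path would pass through `r`; so a cut separates `S'` from `r`. -/
lemma IsCutMedian.isWeightedMedian {S : Multiset (T.Point × ℝ)} (hS : ∀ a ∈ S, 0 ≤ a.2)
    {z r : T.Point} (hr : IsCutMedian S z r) : IsWeightedMedian S r := by
  intro S' hS' hpath
  have hS'S : S' ≤ S := hS'.trans (Multiset.filter_le _ _)
  rcases S'.empty_or_exists_mem with rfl | ⟨a, ha⟩
  · have := weight_nonneg hS
    simp only [weight, Multiset.map_zero, Multiset.sum_zero] at this ⊢
    linarith
  have har : a.1 ≠ r := (Multiset.mem_filter.1 (Multiset.mem_of_le hS' ha)).2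
  obtain ⟨e, her, hne⟩ := exists_contains_proj_ne har.symm
  have bound : ∀ (P : T.Point → Prop) [DecidablePred P], (∀ b ∈ S', P b.1) →
      weight S' ≤ weight (S.filter fun b => P b.1) := fun P _ hP => by
    refine weight_mono (fun b hb => hS b (Multiset.mem_of_mem_filter hb)) ?_
    exact Multiset.le_filter.2 ⟨hS'S, hP⟩
  rcases lt_or_gt_of_ne hne with hlt | hgt
  · refine (bound (fun b => e.proj r < e.proj b) fun b hb => ?_).trans ?_
    · by_contra! hbr
      exact hpath a ha b hb (her.onPath (Set.mem_uIcc.2 (.inr ⟨hbr, hlt.le⟩)) (by linarith))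
    · have := (hr e (e.proj r) (e.proj_nonneg r) (hlt.trans_le (e.proj_le_one _))).not.1 (lt_irrefl _)
      exact not_lt.1 fun h => this (.inl h)
  · have hlt : ∀ b ∈ S', e.proj b.1 < e.proj r := fun b hb => by
      by_contra! hbr
      exact hpath a ha b hb (her.onPath (Set.mem_uIcc.2 (.inl ⟨hgt.le, hbr⟩)) (by linarith))
    -- Cuts are half-open, so a cut that has `r` beyond it and `S'` before it is placed at the
    -- largest projection of `S'`.
    obtain ⟨b, hb, hmax⟩ := Finset.exists_max_image S'.toFinset (fun b => e.proj b.1)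
      ⟨a, Multiset.mem_toFinset.2 ha⟩
    simp only [Multiset.mem_toFinset] at hb hmax
    have hbr := hlt b hb
    refine (bound (fun c => ¬ e.proj b.1 < e.proj c) fun c hc => (hmax c hc).not_gt).trans ?_
    have hmaj := (hr e _ (e.proj_nonneg b.1) (hbr.trans_le (e.proj_le_one r))).1 hbr
    have hsum := weight_filter_add_not S fun c => e.proj b.1 < e.proj c.1
    unfold MajorityBeyond weightBeyond at hmaj
    rcases hmaj with h | ⟨h, -⟩ <;> linarith

/-- Paths between points beyond the cut stay beyond it, and so miss `q`. -/
lemma IsWeightedMedian.weightBeyond_le {S : Multiset (T.Point × ℝ)} {q : T.Point}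
    (hq : IsWeightedMedian S q) {e : T.Edge} {s : ℝ} (h : e.proj q ≤ s) :
    weightBeyond S e s ≤ weight S / 2 := by
  refine hq _ (Multiset.le_filter.2 ⟨Multiset.filter_le _ _, fun a ha haq => ?_⟩) fun a ha b hb hp => ?_
  · have := (Multiset.mem_filter.1 ha).2
    rw [haq] at this
    linarith
  · have h1 := (Multiset.mem_filter.1 ha).2
    have h2 := (Multiset.mem_filter.1 hb).2
    rcases Set.mem_uIcc.1 (onPath_iff.1 hp e) with h3 | h3 <;> linarith

lemma IsWeightedMedian.le_weightBeyond {S : Multiset (T.Point × ℝ)} {q : T.Point}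
    (hq : IsWeightedMedian S q) {e : T.Edge} {s : ℝ} (h : s < e.proj q) :
    weight S / 2 ≤ weightBeyond S e s := by
  have hsum := weight_filter_add_not S fun c => s < e.proj c.1
  suffices weight (S.filter fun a => ¬ s < e.proj a.1) ≤ weight S / 2 by
    unfold weightBeyond; linarith
  refine hq _ (Multiset.le_filter.2 ⟨Multiset.filter_le _ _, fun a ha haq => ?_⟩) fun a ha b hb hp => ?_
  · have := (Multiset.mem_filter.1 ha).2
    rw [haq] at this
    exact this h
  · have h1 := (Multiset.mem_filter.1 ha).2
    have h2 := (Multiset.mem_filter.1 hb).2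
    rcases Set.mem_uIcc.1 (onPath_iff.1 hp e) with h3 | h3 <;> linarith

/-- Otherwise a cut has `q` and `z` on one side and `r` on the other. The side of the median `q` has
at least half of the weight, and the tie rule favours `z`, so `r` would belong there. -/
lemma IsCutMedian.onPath {S : Multiset (T.Point × ℝ)} {z r q : T.Point} (hr : IsCutMedian S z r)
    (hq : IsWeightedMedian S q) : OnPath q z r := by
  refine onPath_iff.2 fun e => ?_
  by_contra hcon
  simp only [Set.mem_uIcc, not_or, not_and_or, not_le] at hcon
  rcases le_or_gt (e.proj r) (max (e.proj q) (e.proj z)) with hle | hgt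
  · have hrq : e.proj r < e.proj q := by grind
    have hrz : e.proj r < e.proj z := by grind
    have := (hr e _ (e.proj_nonneg r) (hrq.trans_le (e.proj_le_one q))).not.1 (lt_irrefl _)
    rcases (hq.le_weightBeyond hrq).lt_or_eq with h | h
    · exact this (.inl h)
    · exact this (.inr ⟨h.symm, hrz⟩)
  · have hmaj := (hr e _ ((e.proj_nonneg q).trans (le_max_left _ _))
      (hgt.trans_le (e.proj_le_one r))).1 hgt
    have hle := hq.weightBeyond_le (le_max_left (e.proj q) (e.proj z))
    rcases hmaj with h | ⟨-, h⟩
    · exact absurd hle h.not_ge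
    · exact absurd (le_max_right _ _) h.not_ge

/-- The cut median is on the path from every weighted median to `z`, so it is the unique closest
one. The default value `z` in the definition is never used. -/
lemma isCutMedian_closestWeightedMedian {S : Multiset (T.Point × ℝ)} (hS : ∀ a ∈ S, 0 ≤ a.2)
    (z : T.Point) : IsCutMedian S z (closestWeightedMedian S z) := by
  obtain ⟨r, hr⟩ := exists_isCutMedian hS z
  have hmed := hr.isWeightedMedian hS
  have hclosest : ∃ p, IsClosestWeightedMedian S z p := by
    refine ⟨r, hmed, fun q hq => ?_⟩
    have := hr.onPath hq
    unfold OnPath at this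
    linarith [treeDist_nonneg q r]
  have heq : closestWeightedMedian S z = r := by
    rw [closestWeightedMedian, dif_pos hclosest]
    obtain ⟨h1, h2⟩ := hclosest.choose_spec
    have := hr.onPath h1
    unfold OnPath at this
    exact eq_of_treeDist_le_zero (by linarith [h2 r hmed])
  rwa [heq]

/-- The closest median is behind a cut if and only if the majority of the points is. -/
lemma lt_proj_closestMedian_iff {m : ℕ} (t : Fin m → T.Point) (z : T.Point) (e : T.Edge) {s : ℝ}
    (hs0 : 0 ≤ s) (hs1 : s < 1) :
    s < e.proj (closestMedian t z) ↔
      (m : ℝ) < 2 * (Finset.univ.filter fun j => s < e.proj (t j)).card ∨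
        2 * ((Finset.univ.filter fun j => s < e.proj (t j)).card : ℝ) = m ∧ s < e.proj z := by
  have hS : ∀ a ∈ Finset.univ.val.map fun j => (t j, (1 : ℝ)), 0 ≤ a.2 := fun a ha => by
    obtain ⟨j, -, rfl⟩ := Multiset.mem_map.1 ha
    exact zero_le_one
  have hw : weight (Finset.univ.val.map fun j => (t j, (1 : ℝ))) = m := by
    rw [weight, Multiset.map_map]
    simp
  have hb : weightBeyond (Finset.univ.val.map fun j => (t j, (1 : ℝ))) e s =
      (Finset.univ.filter fun j => s < e.proj (t j)).card := by
    rw [weightBeyond, weight, Multiset.filter_map, Multiset.map_map]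
    simp only [Function.comp_def, Multiset.map_const', Multiset.sum_replicate, nsmul_eq_mul, mul_one]
    rfl
  rw [closestMedian, isCutMedian_closestWeightedMedian hS z e s hs0 hs1, MajorityBeyond, hw, hb,
    div_lt_iff₀' two_pos, eq_div_iff two_ne_zero, mul_comm _ (2 : ℝ)]

namespace TRM

variable {k : ℕ} {n : Fin k → ℕ} (z : T.Point) (R : Profile T n)

/-! ### The weights of the medians -/

/-- The number of agents of the mediators whose median is behind the cut of the edge `e` at `s`. -/
def medianWeight (e : T.Edge) (s : ℝ) : ℝ := ∑ i with s < e.proj (ell z R i), (n i : ℝ)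

lemma sum_size (A : Finset T.Point) :
    ∑ p ∈ A, size z R p = ∑ i with ell z R i ∈ A, (n i : ℝ) := by
  simp only [size]
  rw [← Finset.sum_fiberwise_of_maps_to (s := Finset.univ.filter fun i => ell z R i ∈ A) (t := A)
    (g := ell z R) (fun i hi => (Finset.mem_filter.1 hi).2)]
  refine Finset.sum_congr rfl fun p hp => Finset.sum_congr ?_ fun _ _ => rfl
  ext i
  simp only [Finset.mem_filter, Finset.mem_univ, true_and]
  exact ⟨fun h => ⟨h ▸ hp, h⟩, fun h => h.2⟩

lemma size_nonneg (p : T.Point) : 0 ≤ size z R p := Finset.sum_nonneg fun _ _ => by positivity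

/-- Merging mediators with a common median and dropping points of size zero changes no weight. -/
lemma weight_filter_L (P : T.Point → Prop) [DecidablePred P] :
    weight ((L z R).filter fun a => P a.1) = ∑ i with P (ell z R i), (n i : ℝ) := by
  have h1 : weight ((L z R).filter fun a => P a.1) =
      ∑ p ∈ ((Finset.univ.image (ell z R)).filter fun p => 0 < size z R p).filter P,
        size z R p := by
    rw [weight, L, Multiset.filter_map, Multiset.map_map]
    rfl
  rw [h1, Finset.filter_comm, Finset.sum_filter_of_ne, sum_size]
  · refine Finset.sum_congr ?_ fun _ _ => rfl
    ext i
    simp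
  · intro p _ hp
    exact lt_of_le_of_ne (size_nonneg z R p) (Ne.symm hp)

lemma weight_L : weight (L z R) = total n := by
  have := weight_filter_L z R fun _ => True
  simpa [total] using this

lemma L_nonneg : ∀ a ∈ L z R, 0 ≤ a.2 := fun a ha => by
  obtain ⟨p, -, rfl⟩ := Multiset.mem_map.1 ha
  exact size_nonneg z R p

lemma isCutMedian_root : IsCutMedian (L z R) z (root z R) :=
  isCutMedian_closestWeightedMedian (L_nonneg z R) z

lemma total_le_of_lt_proj_root {e : T.Edge} {s : ℝ} (hs : 0 ≤ s) (h : s < e.proj (root z R)) :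
    total n ≤ 2 * medianWeight z R e s := by
  have := (isCutMedian_root z R e s hs (h.trans_le (e.proj_le_one _))).1 h
  rw [MajorityBeyond, weightBeyond, weight_L, weight_filter_L z R fun p => s < e.proj p] at this
  unfold medianWeight
  rcases this with h | ⟨h, -⟩ <;> linarith

lemma le_total_of_proj_root_le {e : T.Edge} {s : ℝ} (hs : s < 1) (h : e.proj (root z R) ≤ s) :
    2 * medianWeight z R e s ≤ total n := by
  have := (isCutMedian_root z R e s ((e.proj_nonneg _).trans h) hs).not.1 h.not_gt
  rw [MajorityBeyond, weightBeyond, weight_L, weight_filter_L z R fun p => s < e.proj p] at this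
  unfold medianWeight
  linarith [not_lt.1 fun h => this (.inl h)]

lemma medianWeight_add (e : T.Edge) (s : ℝ) :
    medianWeight z R e s + ∑ i with ¬ s < e.proj (ell z R i), (n i : ℝ) = total n :=
  Finset.sum_filter_add_sum_filter_not _ _ _

/-! ### The rooted split tree -/

lemma node_mem_nodes (v : V) : T.node v ∈ nodes z R := by simp [nodes]

lemma root_mem_nodes : root z R ∈ nodes z R := by simp [nodes]

lemma ell_mem_nodes (i : Fin k) : ell z R i ∈ nodes z R := by simp [nodes]

variable {z R}

lemma mem_subtree {u v : T.Point} : v ∈ subtree z R u ↔ v ∈ nodes z R ∧ OnPath (root z R) v u := by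
  simp [subtree]

lemma mem_children {u v : T.Point} :
    v ∈ children z R u ↔ v ∈ nodes z R ∧ Adjacent z R u v ∧ OnPath (root z R) v u := by
  simp [children]

lemma ne_root_of_mem_children {u v : T.Point} (h : v ∈ children z R u) : v ≠ root z R := by
  rintro rfl
  rw [mem_children] at h
  exact h.2.1.1 h.2.2.eq_left

/-- The parent is the node farthest from the root among those strictly above `v`. -/
lemma exists_mem_children {v : T.Point} (hv : v ∈ nodes z R) (hr : v ≠ root z R) :
    ∃ u ∈ nodes z R, v ∈ children z R u := by
  obtain ⟨u, hu, hmax⟩ := Finset.exists_max_image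
    ((nodes z R).filter fun u => u ≠ v ∧ OnPath (root z R) v u) (treeDist (root z R))
    ⟨root z R, by simp [root_mem_nodes, hr.symm, onPath_left]⟩
  simp only [Finset.mem_filter] at hu hmax
  refine ⟨u, hu.1, mem_children.2 ⟨hv, ⟨hu.2.1, fun w hw hpath => ?_⟩, hu.2.2⟩⟩
  by_cases hwv : w = v
  · exact .inr hwv
  left
  have hu2 := hu.2.2
  have hwr : OnPath (root z R) v w := by
    unfold OnPath at *
    linarith [treeDist_triangle (root z R) u w, treeDist_triangle (root z R) w v]
  have := hmax w ⟨hw, hwv, hwr⟩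
  unfold OnPath at *
  exact (eq_of_treeDist_le_zero (by linarith)).symm

/-- A node strictly above a child of `u` is above `u`. -/
lemma onPath_of_mem_children {u v x : T.Point} (h : v ∈ children z R u) (hx : x ∈ nodes z R)
    (hxv : x ≠ v) (hpath : OnPath (root z R) v x) : OnPath (root z R) u x := by
  rw [mem_children] at h
  rcases hpath.total h.2.2 with h1 | h1
  · exact h1
  · rcases h.2.1.2 x hx (hpath.trans' h1) with h2 | h2
    · rw [h2]; exact onPath_right _ _
    · exact absurd h2 hxv

lemma eq_of_mem_children {u u' v : T.Point} (hu : u ∈ nodes z R) (hu' : u' ∈ nodes z R)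
    (h : v ∈ children z R u) (h' : v ∈ children z R u') : u = u' := by
  have h1 := mem_children.1 h
  have h2 := mem_children.1 h'
  exact (onPath_of_mem_children h' hu h1.2.1.1 h1.2.2).antisymm
    (onPath_of_mem_children h hu' h2.2.1.1 h2.2.2)

lemma erase_subtree_eq {u : T.Point} (hu : u ∈ nodes z R) :
    (subtree z R u).erase u = (subtree z R u).biUnion (children z R) := by
  ext v
  simp only [Finset.mem_erase, Finset.mem_biUnion, mem_subtree]
  constructor
  · rintro ⟨hvu, hv, hpath⟩
    have hvr : v ≠ root z R := by
      rintro rfl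
      exact hvu hpath.eq_left.symm
    obtain ⟨w, hw, hvw⟩ := exists_mem_children hv hvr
    exact ⟨w, ⟨hw, onPath_of_mem_children hvw hu hvu.symm hpath⟩, hvw⟩
  · rintro ⟨w, ⟨hw, hpath⟩, hvw⟩
    have h := mem_children.1 hvw
    refine ⟨?_, h.1, h.2.2.trans hpath⟩
    rintro rfl
    exact h.2.1.1 (h.2.2.antisymm hpath)

/-- Telescoping: every node of the subtree except `u` is subtracted exactly once, at its unique
parent. -/
lemma sum_subtree_sub_sum_children (g : T.Point → ℝ) {u : T.Point} (hu : u ∈ nodes z R) :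
    ∑ v ∈ subtree z R u, (g v - ∑ w ∈ children z R v, g w) = g u := by
  rw [Finset.sum_sub_distrib, ← Finset.sum_biUnion, ← erase_subtree_eq hu,
    ← Finset.add_sum_erase _ g (mem_subtree.2 ⟨hu, onPath_right _ _⟩)]
  · ring
  · intro v hv w hw hvw
    refine Finset.disjoint_left.2 fun x hxv hxw => hvw ?_
    exact eq_of_mem_children (mem_subtree.1 hv).1 (mem_subtree.1 hw).1 hxv hxw

/-- Subtrees of different children are disjoint: the nodes above a common node are linearly ordered,
but no child is above another. -/
lemma sum_children_treesize_le (u : T.Point) (C : Finset T.Point) (hC : C ⊆ children z R u) :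
    ∑ v ∈ C, treesize z R v ≤ treesize z R u := by
  simp only [treesize]
  rw [← Finset.sum_biUnion]
  · refine Finset.sum_le_sum_of_subset_of_nonneg ?_ fun v _ _ => size_nonneg z R v
    refine Finset.biUnion_subset.2 fun v hv w hw => ?_
    rw [mem_subtree] at hw ⊢
    exact ⟨hw.1, hw.2.trans (mem_children.1 (hC hv)).2.2⟩
  · have key : ∀ v ∈ C, ∀ w ∈ C, OnPath (root z R) w v → v = w := by
      intro v hv w hw hpath
      by_contra hvw
      have hv' := mem_children.1 (hC hv)
      have := onPath_of_mem_children (hC hw) hv'.1 hvw hpath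
      exact hv'.2.1.1 (hv'.2.2.antisymm this)
    intro v hv w hw hvw
    refine Finset.disjoint_left.2 fun x hxv hxw => hvw ?_
    rcases (mem_subtree.1 hxv).2.total (mem_subtree.1 hxw).2 with h | h
    · exact key v hv w hw h
    · exact (key w hw v hv h).symm

lemma treesize_anti {u v : T.Point} (h : OnPath (root z R) v u) :
    treesize z R v ≤ treesize z R u := by
  refine Finset.sum_le_sum_of_subset_of_nonneg (fun w hw => ?_) fun v _ _ => size_nonneg z R v
  rw [mem_subtree] at hw ⊢
  exact ⟨hw.1, hw.2.trans h⟩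

variable (z R) in
lemma subtree_root : subtree z R (root z R) = nodes z R := by
  ext v; simp [mem_subtree, onPath_left]

lemma treesize_eq (u : T.Point) :
    treesize z R u = ∑ i with OnPath (root z R) (ell z R i) u, (n i : ℝ) := by
  rw [treesize, sum_size]
  simp [mem_subtree, ell_mem_nodes]

variable (z R) in
lemma treesize_root : treesize z R (root z R) = total n := by
  simp [treesize_eq, onPath_left, total]

/-- A cut separates the subtree of `u` from the root, and the root is on the majority side of it. -/
lemma two_mul_treesize_le {u : T.Point} (hu : u ≠ root z R) :
    2 * treesize z R u ≤ total n := by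
  obtain ⟨e, -, hne⟩ := exists_contains_proj_ne hu
  rw [treesize_eq]
  rcases lt_or_gt_of_ne hne with h | h
  · have h1 := total_le_of_lt_proj_root z R (e.proj_nonneg u) h
    have h2 := medianWeight_add z R e (e.proj u)
    have h3 : ∑ i with OnPath (root z R) (ell z R i) u, (n i : ℝ) ≤
        ∑ i with ¬ e.proj u < e.proj (ell z R i), (n i : ℝ) := by
      refine Finset.sum_le_sum_of_subset_of_nonneg (fun i hi => ?_) fun i _ _ => by positivity
      simp only [Finset.mem_filter, Finset.mem_univ, true_and] at hi ⊢
      rcases Set.mem_uIcc.1 (onPath_iff.1 hi e) with h4 | h4 <;> linarith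
    linarith
  · have h1 := le_total_of_proj_root_le z R (h.trans_le (e.proj_le_one u)) le_rfl
    have h3 : ∑ i with OnPath (root z R) (ell z R i) u, (n i : ℝ) ≤
        medianWeight z R e (e.proj (root z R)) := by
      refine Finset.sum_le_sum_of_subset_of_nonneg (fun i hi => ?_) fun i _ _ => by positivity
      simp only [Finset.mem_filter, Finset.mem_univ, true_and] at hi ⊢
      rcases Set.mem_uIcc.1 (onPath_iff.1 hi e) with h4 | h4 <;> linarith
    linarith

/-! ### The distribution of the facility -/

variable (z R) in
/-- The probability that the facility is in the subtree of `u`. -/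
def subtreeProb (u : T.Point) : ℝ :=
  if u ∈ X z R then (treesize z R u - c z R u) / (total n / 2) else 0

lemma mem_X {u : T.Point} : u ∈ X z R ↔ u ∈ nodes z R ∧ total n / 4 ≤ treesize z R u := by
  simp [X]

/-- Works also for `u ∉ X`, because `treesize` grows towards the root: then no child of `u` is in
`X`. -/
lemma prob_eq {u : T.Point} (hu : u ∈ nodes z R) :
    prob z R u = subtreeProb z R u - ∑ v ∈ children z R u, subtreeProb z R v := by
  by_cases h : u ∈ X z R
  · rw [prob, if_pos h, subtreeProb, if_pos h, Finset.sum_div]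
    simp only [subtreeProb]
    rw [← Finset.sum_filter, Finset.inter_comm, Finset.filter_mem_eq_inter]
  · rw [prob, if_neg h, subtreeProb, if_neg h, Finset.sum_eq_zero, sub_zero]
    intro v hv
    have hv' := mem_children.1 hv
    rw [subtreeProb, if_neg]
    intro hvX
    exact h (mem_X.2 ⟨hu, (mem_X.1 hvX).2.trans (treesize_anti hv'.2.2)⟩)

lemma sum_subtree_prob {u : T.Point} (hu : u ∈ nodes z R) :
    ∑ v ∈ subtree z R u, prob z R v = subtreeProb z R u := by
  rw [← sum_subtree_sub_sum_children (subtreeProb z R) hu]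
  exact Finset.sum_congr rfl fun v hv => prob_eq (mem_subtree.1 hv).1

lemma prob_eq_zero {u : T.Point} (hu : u ∉ nodes z R) : prob z R u = 0 :=
  if_neg fun h => hu (mem_X.1 h).1

variable (z R) in
lemma sum_prob (hn : 0 < total n) : ∑ v ∈ nodes z R, prob z R v = 1 := by
  rw [← subtree_root, sum_subtree_prob (root_mem_nodes z R), subtreeProb, treesize_root, c, if_pos rfl,
    if_pos (mem_X.2 ⟨root_mem_nodes z R, by rw [treesize_root]; linarith⟩)]
  field_simp
  norm_num

variable (z R) in
-- Each child in `X` subtracts its `treesize` less `n/4`. Below the root, one such child already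
-- makes up for `c u = n/4`. At the root, two children make up for `n/2`; a single one has
-- `treesize` at most `n/2`.
lemma prob_nonneg (hn : 0 < total n) (u : T.Point) : 0 ≤ prob z R u := by
  by_cases h : u ∈ X z R
  · rw [prob, if_pos h, ← sub_div]
    refine div_nonneg ?_ (by linarith)
    set C := X z R ∩ children z R u with hC
    have hCr : ∀ v ∈ C, v ≠ root z R := fun v hv =>
      ne_root_of_mem_children (Finset.mem_inter.1 hv).2
    have hsum : ∑ v ∈ C, (treesize z R v - c z R v) =
        ∑ v ∈ C, treesize z R v - C.card * (total n / 4) := by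
      have hc : ∀ v ∈ C, c z R v = total n / 4 := fun v hv => if_neg (hCr v hv)
      rw [Finset.sum_sub_distrib, Finset.sum_congr rfl hc, Finset.sum_const, nsmul_eq_mul]
    have hle := sum_children_treesize_le u C Finset.inter_subset_right
    rcases Nat.eq_zero_or_pos C.card with h0 | h0
    · rw [Finset.card_eq_zero.1 h0, Finset.sum_empty, c]
      split_ifs with hur
      · rw [hur, treesize_root]; linarith
      · linarith [(mem_X.1 h).2]
    · rw [hsum, c]
      have h1 : (1 : ℝ) ≤ C.card := by exact_mod_cast h0
      split_ifs with hur
      · rcases Nat.lt_or_ge 1 C.card with h2 | h2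
        · have h2' : (2 : ℝ) ≤ C.card := by exact_mod_cast h2
          nlinarith
        · obtain ⟨v, hv⟩ := Finset.card_eq_one.1 (le_antisymm h2 h0)
          have := two_mul_treesize_le (hCr v (by simp [hv]))
          rw [hv, hur, treesize_root]
          simp only [Finset.sum_singleton, Finset.card_singleton, Nat.cast_one]
          linarith
      · nlinarith
  · rw [prob, if_neg h]

/-- The probability that the facility is behind a cut, as a function of the fraction of the weight that
is behind it. -/
def ramp (x : ℝ) : ℝ := max 0 (min 1 (2 * x - 1 / 2))

lemma ramp_mono : Monotone ramp := fun x y h => by unfold ramp; gcongr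

lemma ramp_nonneg (x : ℝ) : 0 ≤ ramp x := le_max_left _ _

/-- This symmetry makes the formula for a cut independent of the side on which the root lies. -/
lemma ramp_one_sub (x : ℝ) : ramp (1 - x) = 1 - ramp x := by
  unfold ramp; grind

/-- The share is at most `1/2`, so the upper clip is inactive; the lower clip is the threshold `n/4`
of `X`. -/
lemma subtreeProb_eq_ramp (hn : 0 < total n) {u : T.Point} (hu : u ∈ nodes z R)
    (hr : u ≠ root z R) : subtreeProb z R u = ramp (treesize z R u / total n) := by
  have h1 := two_mul_treesize_le hr
  have h2 : treesize z R u / total n ≤ 1 / 2 := by rw [div_le_iff₀ hn]; linarith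
  rw [subtreeProb, c, if_neg hr, ramp, min_eq_right (by linarith)]
  split_ifs with h
  · have h3 := (mem_X.1 h).2
    have h4 : 1 / 4 ≤ treesize z R u / total n := by rw [le_div_iff₀ hn]; linarith
    rw [max_eq_right (by linarith)]
    field_simp
    ring
  · have h3 : treesize z R u < total n / 4 := not_le.1 fun h' => h (mem_X.2 ⟨hu, h'⟩)
    have h4 : treesize z R u / total n < 1 / 4 := by rw [div_lt_iff₀ hn]; linarith
    rw [max_eq_left (by linarith)]

variable (z R) in
/-- The probability that the facility is behind a cut. -/
lemma sum_prob_beyond (hn : 0 < total n) (e : T.Edge) {s : ℝ} (hs0 : 0 ≤ s) (hs1 : s < 1) :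
    ∑ v ∈ nodes z R with s < e.proj v, prob z R v = ramp (medianWeight z R e s / total n) := by
  rcases le_or_gt (e.proj (root z R)) s with h | h
  · obtain ⟨u, hu, hue, hus, hmin⟩ := e.exists_next (node_mem_nodes z R) hs1
    have hur : u ≠ root z R := by rintro rfl; exact absurd hus h.not_gt
    have hiff : ∀ v ∈ nodes z R, s < e.proj v ↔ OnPath (root z R) v u := by
      intro v hv
      constructor
      · intro hsv
        have := hmin v hv hsv
        exact hue.onPath (Set.mem_uIcc.2 (.inl ⟨by linarith, this⟩)) (by linarith)
      · intro hpath
        rcases Set.mem_uIcc.1 (onPath_iff.1 hpath e) with h4 | h4 <;> linarith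
    have hset : (nodes z R).filter (fun v => s < e.proj v) = subtree z R u :=
      Finset.filter_congr hiff
    have hw : medianWeight z R e s = treesize z R u := by
      rw [treesize_eq, medianWeight]
      exact Finset.sum_congr (Finset.filter_congr fun i _ => hiff _ (ell_mem_nodes z R i))
        fun _ _ => rfl
    rw [hset, hw, sum_subtree_prob hu, subtreeProb_eq_ramp hn hu hur]
  · obtain ⟨u, hu, hue, hus, hmax⟩ := e.exists_prev (node_mem_nodes z R) hs0
    have hur : u ≠ root z R := by rintro rfl; exact absurd h hus.not_gt
    have hiff : ∀ v ∈ nodes z R, ¬ s < e.proj v ↔ OnPath (root z R) v u := by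
      intro v hv
      constructor
      · intro hsv
        have := hmax v hv (not_lt.1 hsv)
        exact hue.onPath (Set.mem_uIcc.2 (.inr ⟨this, by linarith⟩)) (by linarith)
      · intro hpath
        rcases Set.mem_uIcc.1 (onPath_iff.1 hpath e) with h4 | h4 <;> linarith
    have hset : (nodes z R).filter (fun v => ¬ s < e.proj v) = subtree z R u :=
      Finset.filter_congr hiff
    have hw : ∑ i with ¬ s < e.proj (ell z R i), (n i : ℝ) = treesize z R u := by
      rw [treesize_eq]
      exact Finset.sum_congr (Finset.filter_congr fun i _ => hiff _ (ell_mem_nodes z R i))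
        fun _ _ => rfl
    have h1 := Finset.sum_filter_add_sum_filter_not (nodes z R) (fun v => s < e.proj v) (prob z R)
    rw [hset, sum_prob z R hn, sum_subtree_prob hu, subtreeProb_eq_ramp hn hu hur] at h1
    have h2 := medianWeight_add z R e s
    have h3 : medianWeight z R e s / total n = 1 - treesize z R u / total n := by
      rw [← hw, ← h2]
      rw [← h2] at hn
      field_simp
      ring
    rw [h3, ramp_one_sub]
    linarith

end TRM

/-! ### Comparing costs cut by cut -/

/-- Whether the cut of the edge `e` at `s` separates `p` and `q`. -/
def cutSep (e : T.Edge) (s : ℝ) (p q : T.Point) : ℝ :=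
  if (s < e.proj p ↔ s < e.proj q) then 0 else 1

lemma cutSep_eq_indicator (e : T.Edge) (p q : T.Point) :
    (fun s => cutSep e s p q) =
      (Set.Ico (min (e.proj p) (e.proj q)) (max (e.proj p) (e.proj q))).indicator 1 := by
  funext s
  simp only [cutSep, Set.indicator_apply, Set.mem_Ico, Pi.one_apply, min_le_iff, lt_max_iff]
  by_cases h1 : s < e.proj p <;> by_cases h2 : s < e.proj q <;>
    simp [h1, h2, not_le.2, not_lt.1]

lemma integrableOn_cutSep (e : T.Edge) (p q : T.Point) :
    MeasureTheory.IntegrableOn (fun s => cutSep e s p q) (Set.Ico 0 1) := by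
  rw [cutSep_eq_indicator]
  refine MeasureTheory.IntegrableOn.indicator ?_ measurableSet_Ico
  exact MeasureTheory.integrableOn_const (by simp)

lemma integral_cutSep (e : T.Edge) (p q : T.Point) :
    ∫ s in Set.Ico (0 : ℝ) 1, cutSep e s p q = |e.proj p - e.proj q| := by
  rw [cutSep_eq_indicator, MeasureTheory.setIntegral_indicator measurableSet_Ico,
    Set.inter_eq_right.2]
  · simp [max_sub_min_eq_abs, abs_sub_comm]
  · exact Set.Ico_subset_Ico (le_min (e.proj_nonneg p) (e.proj_nonneg q))
      (max_le (e.proj_le_one p) (e.proj_le_one q))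

/-- The difference of two projections is the measure of the cuts of that edge between them. -/
lemma sum_mul_treeDist {ι : Type*} (I : Finset ι) (c : ι → ℝ) (p q : ι → T.Point) :
    ∑ i ∈ I, c i * treeDist (p i) (q i) =
      ∑ e : T.Edge, T.len e.1 *
        ∫ s in Set.Ico (0 : ℝ) 1, ∑ i ∈ I, c i * cutSep e s (p i) (q i) := by
  simp only [treeDist_eq, Finset.mul_sum]
  rw [Finset.sum_comm]
  refine Finset.sum_congr rfl fun e _ => ?_
  rw [MeasureTheory.integral_finsetSum _ fun i _ => (integrableOn_cutSep e _ _).const_mul _,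
    Finset.mul_sum]
  refine Finset.sum_congr rfl fun i _ => ?_
  rw [MeasureTheory.integral_const_mul, integral_cutSep]
  ring

/-- An inequality between combinations of distances holds if it holds for every cut. -/
lemma sum_mul_treeDist_le {ι κ : Type*} (I : Finset ι) (J : Finset κ) (c : ι → ℝ) (d : κ → ℝ)
    (p q : ι → T.Point) (p' q' : κ → T.Point)
    (h : ∀ (e : T.Edge) (s : ℝ), 0 ≤ s → s < 1 →
      ∑ i ∈ I, c i * cutSep e s (p i) (q i) ≤ ∑ j ∈ J, d j * cutSep e s (p' j) (q' j)) :
    ∑ i ∈ I, c i * treeDist (p i) (q i) ≤ ∑ j ∈ J, d j * treeDist (p' j) (q' j) := by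
  rw [sum_mul_treeDist, sum_mul_treeDist]
  refine Finset.sum_le_sum fun e _ => mul_le_mul_of_nonneg_left ?_ (T.len_pos e.1 e.2).le
  refine MeasureTheory.setIntegral_mono_on ?_ ?_ measurableSet_Ico fun s hs => h e s hs.1 hs.2
  · exact MeasureTheory.integrable_finsetSum _ fun i _ => (integrableOn_cutSep e _ _).const_mul _
  · exact MeasureTheory.integrable_finsetSum _ fun i _ => (integrableOn_cutSep e _ _).const_mul _

/-- The number of the points `t a` behind a cut. -/
def countBeyond {ι : Type*} [Fintype ι] (t : ι → T.Point) (e : T.Edge) (s : ℝ) : ℝ :=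
  (Finset.univ.filter fun a => s < e.proj (t a)).card

lemma countBeyond_mono {ι : Type*} [Fintype ι] {t t' : ι → T.Point} {e : T.Edge} {s : ℝ}
    (h : ∀ a, s < e.proj (t a) → s < e.proj (t' a)) : countBeyond t e s ≤ countBeyond t' e s := by
  unfold countBeyond
  exact_mod_cast Finset.card_le_card (Finset.monotone_filter_right _ fun a _ => h a)

lemma sum_ite_beyond {ι : Type*} [Fintype ι] (t : ι → T.Point) (e : T.Edge) (s x y : ℝ) :
    ∑ a, (if s < e.proj (t a) then x else y) =
      countBeyond t e s * x + (Fintype.card ι - countBeyond t e s) * y := by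
  have : (Fintype.card ι : ℝ) = countBeyond t e s +
      (Finset.univ.filter fun a => ¬ s < e.proj (t a)).card := by
    unfold countBeyond
    rw [← Finset.card_univ]
    exact_mod_cast (Finset.card_filter_add_card_filter_not _).symm
  rw [Finset.sum_ite, Finset.sum_const, Finset.sum_const, nsmul_eq_mul, nsmul_eq_mul, this]
  simp [countBeyond]

lemma lt_proj_closestMedian_mono {m : ℕ} {t t' : Fin m → T.Point} {z : T.Point} {e : T.Edge} {s : ℝ}
    (hs0 : 0 ≤ s) (hs1 : s < 1) (h : ∀ j, s < e.proj (t j) → s < e.proj (t' j))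
    (ht : s < e.proj (closestMedian t z)) : s < e.proj (closestMedian t' z) := by
  rw [lt_proj_closestMedian_iff _ _ _ hs0 hs1] at ht ⊢
  have := countBeyond_mono h
  unfold countBeyond at this
  rcases ht with h1 | ⟨h1, h2⟩
  · left; linarith
  · rcases this.eq_or_lt with h3 | h3
    · right; exact ⟨by linarith, h2⟩
    · left; linarith

lemma le_two_mul_countBeyond {m : ℕ} {t : Fin m → T.Point} {z : T.Point} {e : T.Edge} {s : ℝ}
    (hs0 : 0 ≤ s) (hs1 : s < 1) (h : s < e.proj (closestMedian t z)) :
    (m : ℝ) ≤ 2 * countBeyond t e s := by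
  rw [lt_proj_closestMedian_iff _ _ _ hs0 hs1] at h
  unfold countBeyond
  rcases h with h | ⟨h, -⟩ <;> linarith

lemma two_mul_countBeyond_le {m : ℕ} {t : Fin m → T.Point} {z : T.Point} {e : T.Edge} {s : ℝ}
    (hs0 : 0 ≤ s) (hs1 : s < 1) (h : ¬ s < e.proj (closestMedian t z)) :
    2 * countBeyond t e s ≤ m := by
  rw [lt_proj_closestMedian_iff _ _ _ hs0 hs1] at h
  exact not_lt.1 fun h' => h (.inl h')

/-! ### Existence, incentive compatibility and competitive ratio of the mechanism -/

namespace TRM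

variable {k : ℕ} {n : Fin k → ℕ} {z : T.Point} {M : RandomizedMechanism T n}

variable (z) in
/-- The Tree Randomized Mechanism exists. -/
lemma exists_isTRM (hn : 0 < total n) : ∃ M : RandomizedMechanism T n, IsTRM z M := by
  refine ⟨fun R => PMF.ofFinset (fun u => ENNReal.ofReal (prob z R u)) (nodes z R) ?_ ?_, ?_⟩
  · rw [← ENNReal.ofReal_sum_of_nonneg fun u _ => prob_nonneg z R hn u, sum_prob z R hn,
      ENNReal.ofReal_one]
  · intro u hu
    rw [prob_eq_zero hu, ENNReal.ofReal_zero]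
  · intro R u
    rw [PMF.ofFinset_apply, ENNReal.toReal_ofReal (prob_nonneg z R hn u)]

lemma expectedCost_eq (hM : IsTRM z M) (R : Profile T n) (cost : T.Point → ℝ) :
    expectedCost (M R) cost = ∑ u ∈ nodes z R, prob z R u * cost u := by
  rw [expectedCost, tsum_eq_sum fun u hu => ?_]
  · exact Finset.sum_congr rfl fun u _ => by rw [hM R u]
  · rw [hM R u, prob_eq_zero hu, zero_mul]

lemma expectedCost_sum_treeDist (hM : IsTRM z M) (R : Profile T n) {ι : Type*} [Fintype ι]
    (t : ι → T.Point) : expectedCost (M R) (fun x => ∑ a, treeDist x (t a)) =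
      ∑ x ∈ nodes z R ×ˢ Finset.univ, prob z R x.1 * treeDist x.1 (t x.2) := by
  rw [expectedCost_eq hM, Finset.sum_product]
  simp only [Finset.mul_sum]

variable (z) in
-- If the facility is beyond the cut with probability `ρ`, a point beyond is separated from it with
-- probability `1 - ρ`, and any other point with probability `ρ`.
lemma sum_prob_mul_cutSep (hn : 0 < total n) (R : Profile T n) {ι : Type*} [Fintype ι]
    (t : ι → T.Point) (e : T.Edge) {s : ℝ} (hs0 : 0 ≤ s) (hs1 : s < 1) :
    ∑ x ∈ nodes z R ×ˢ Finset.univ, prob z R x.1 * cutSep e s x.1 (t x.2) =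
      countBeyond t e s + (Fintype.card ι - 2 * countBeyond t e s) *
        ramp (medianWeight z R e s / total n) := by
  have key : ∀ a, ∑ u ∈ nodes z R, prob z R u * cutSep e s u (t a) =
      if s < e.proj (t a) then 1 - ramp (medianWeight z R e s / total n)
        else ramp (medianWeight z R e s / total n) := by
    intro a
    have h1 := Finset.sum_filter_add_sum_filter_not (nodes z R) (fun v => s < e.proj v) (prob z R)
    rw [sum_prob z R hn] at h1
    rw [← sum_prob_beyond z R hn e hs0 hs1]
    split_ifs with h
    · rw [← h1, add_sub_cancel_left, Finset.sum_filter]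
      exact Finset.sum_congr rfl fun u _ => by by_cases hu : s < e.proj u <;> simp [cutSep, h, hu]
    · rw [Finset.sum_filter]
      exact Finset.sum_congr rfl fun u _ => by by_cases hu : s < e.proj u <;> simp [cutSep, h, hu]
  rw [Finset.sum_product_right, Finset.sum_congr rfl fun a _ => key a, sum_ite_beyond]
  ring

/-- Serves both incentive constraints: the reports enter the cost on a cut only through `ramp`,
whose coefficient is given by the true locations. -/
lemma expectedCost_le_expectedCost (hn : 0 < total n) (hM : IsTRM z M) (R R' : Profile T n)
    {ι : Type*} [Fintype ι] (t : ι → T.Point)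
    (h : ∀ (e : T.Edge) (s : ℝ), 0 ≤ s → s < 1 →
      (Fintype.card ι - 2 * countBeyond t e s) * ramp (medianWeight z R e s / total n) ≤
        (Fintype.card ι - 2 * countBeyond t e s) * ramp (medianWeight z R' e s / total n)) :
    expectedCost (M R) (fun x => ∑ a, treeDist x (t a)) ≤
      expectedCost (M R') (fun x => ∑ a, treeDist x (t a)) := by
  rw [expectedCost_sum_treeDist hM, expectedCost_sum_treeDist hM]
  refine sum_mul_treeDist_le _ _ (fun x : T.Point × ι => prob z R x.1)
    (fun x : T.Point × ι => prob z R' x.1) _ _ _ _ ?_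
  intro e s hs0 hs1
  rw [sum_prob_mul_cutSep z hn R t e hs0 hs1, sum_prob_mul_cutSep z hn R' t e hs0 hs1]
  linarith [h e s hs0 hs1]

lemma ramp_medianWeight_mono (hn : 0 < total n) {R R' : Profile T n} {e : T.Edge} {s : ℝ}
    (h : ∀ i, s < e.proj (ell z R i) → s < e.proj (ell z R' i)) :
    ramp (medianWeight z R e s / total n) ≤ ramp (medianWeight z R' e s / total n) := by
  refine ramp_mono (div_le_div_of_nonneg_right ?_ hn.le)
  refine Finset.sum_le_sum_of_subset_of_nonneg ?_ fun i _ _ => by positivity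
  exact Finset.monotone_filter_right _ fun i _ => h i

lemma agentSideIC (hn : 0 < total n) (hM : IsTRM z M) : AgentSideIC M := by
  intro i σ hσ a j t t'
  have key := expectedCost_le_expectedCost hn hM (forward σ (setMessage a i j t))
    (forward σ (setMessage a i j t')) (fun _ : Unit => t) ?_
  · simpa using key
  -- Moving one report across the cut moves no median the opposite way. Other mediators receive
  -- unchanged messages, so their strategies do not matter.
  have mono : ∀ (e : T.Edge) (s : ℝ), 0 ≤ s → s < 1 → ∀ t t' : T.Point,
      (s < e.proj t → s < e.proj t') →
      ramp (medianWeight z (forward σ (setMessage a i j t)) e s / total n) ≤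
        ramp (medianWeight z (forward σ (setMessage a i j t')) e s / total n) := by
    intro e s hs0 hs1 t t' htt'
    refine ramp_medianWeight_mono hn fun i' => ?_
    refine lt_proj_closestMedian_mono hs0 hs1 fun j' => ?_
    by_cases hi : i' = i
    · subst hi
      simp only [forward, setMessage, hσ, Function.update_self, id]
      by_cases hj : j' = j
      · subst hj; simpa using htt'
      · simp [hj]
    · simp [forward, setMessage, hi]
  intro e s hs0 hs1
  by_cases h : s < e.proj t
  · have := mono e s hs0 hs1 t' t fun _ => h
    simp only [countBeyond, h, Fintype.card_unit, Finset.filter_true, Finset.card_univ]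
    linarith
  · have := mono e s hs0 hs1 t t' fun h' => absurd h' h
    simp only [countBeyond, h, Fintype.card_unit, Finset.filter_false, Finset.card_empty]
    linarith

/-- The sign of the coefficient of `ramp` is decided by the side of the truthful median, and truth
puts all of the mediator's weight on that side. -/
lemma mediatorSideIC (hn : 0 < total n) (hM : IsTRM z M) : MediatorSideIC M := by
  intro i a σ
  refine expectedCost_le_expectedCost hn hM _ _ (a i) fun e s hs0 hs1 => ?_
  rw [Fintype.card_fin]
  have hself : ell z (forward (Function.update σ i id) a) i = closestMedian (a i) z := by
    simp [ell, forward]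
  have hother : ∀ i' ≠ i, ell z (forward (Function.update σ i id) a) i' = ell z (forward σ a) i' := by
    intro i' hi
    simp [ell, forward, hi]
  by_cases h : s < e.proj (closestMedian (a i) z)
  · refine mul_le_mul_of_nonpos_left ?_ (by linarith [le_two_mul_countBeyond hs0 hs1 h])
    refine ramp_medianWeight_mono hn fun i' hi' => ?_
    by_cases hi : i' = i
    · rw [hi, hself]; exact h
    · rwa [hother i' hi]
  · refine mul_le_mul_of_nonneg_left ?_ (by linarith [two_mul_countBeyond_le hs0 hs1 h])
    refine ramp_medianWeight_mono hn fun i' hi' => ?_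
    by_cases hi : i' = i
    · rw [hi, hself] at hi'; exact absurd hi' h
    · rwa [hother i' hi] at hi'

lemma one_sub_two_mul_mul_ramp_le {b w : ℝ} (hb : 0 ≤ b) (hw : w ≤ 2 * b) :
    (1 - 2 * b) * ramp w ≤ b := by
  rcases le_or_gt (1 / 2) b with h | h
  · nlinarith [ramp_nonneg w]
  · refine (mul_le_mul_of_nonneg_left (ramp_mono hw) (by linarith)).trans ?_
    rcases max_cases 0 (min 1 (2 * (2 * b) - 1 / 2)) with h1 | h1
    · rw [ramp, h1.1, mul_zero]; exact hb
    · rw [ramp, h1.1]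
      -- `(1 - 2b)(4b - 1/2) - b = -8(b - 1/4)^2`.
      nlinarith [min_le_right 1 (2 * (2 * b) - 1 / 2), sq_nonneg (b - 1 / 4)]

lemma countBeyond_sigma (t : Profile T n) (e : T.Edge) (s : ℝ) :
    countBeyond (fun a : Σ i, Fin (n i) => t a.1 a.2) e s = ∑ i, countBeyond (t i) e s := by
  have h := sum_ite_beyond (fun a : Σ i, Fin (n i) => t a.1 a.2) e s 1 0
  rw [Fintype.sum_sigma] at h
  simp only [sum_ite_beyond, mul_one, mul_zero, add_zero] at h
  exact h.symm

lemma isCompetitive (hn : 0 < total n) (hM : IsTRM z M) : IsCompetitive 2 M := by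
  intro t q
  let t' : (Σ i, Fin (n i)) → T.Point := fun a => t a.1 a.2
  have hcost : socialCost t = fun x => ∑ a, treeDist x (t' a) := by
    funext x
    rw [socialCost, Fintype.sum_sigma]
  have hcard : (Fintype.card (Σ i, Fin (n i)) : ℝ) = total n := by
    simp [total]
  rw [hcost, expectedCost_sum_treeDist hM, Finset.mul_sum]
  refine sum_mul_treeDist_le _ _ (fun x : T.Point × (Σ i, Fin (n i)) => prob z t x.1)
    (fun _ => 2) _ _ (fun _ => q) t' ?_
  intro e s hs0 hs1
  rw [sum_prob_mul_cutSep z hn t t' e hs0 hs1, hcard]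
  have hm : countBeyond t' e s = ∑ i, countBeyond (t i) e s := countBeyond_sigma t e s
  have hle : ∀ i, countBeyond (t i) e s ≤ n i := fun i => by
    unfold countBeyond
    exact_mod_cast (Finset.card_le_univ _).trans_eq (Fintype.card_fin _)
  have hnn : ∀ i, 0 ≤ countBeyond (t i) e s := fun i => Nat.cast_nonneg _
  -- A mediator whose median is beyond the cut has at least half of his agents there; `hW2` is the
  -- same for the other side.
  have hW1 : medianWeight z t e s ≤ 2 * countBeyond t' e s := by
    rw [hm, Finset.mul_sum, medianWeight, Finset.sum_filter]
    refine Finset.sum_le_sum fun i _ => ?_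
    split_ifs with h
    · exact le_two_mul_countBeyond hs0 hs1 h
    · linarith [hnn i]
  have hW2 : total n - medianWeight z t e s ≤ 2 * (total n - countBeyond t' e s) := by
    rw [hm, total, medianWeight, Finset.sum_filter, ← Finset.sum_sub_distrib,
      ← Finset.sum_sub_distrib, Finset.mul_sum]
    refine Finset.sum_le_sum fun i _ => ?_
    split_ifs with h
    · linarith [hle i]
    · linarith [two_mul_countBeyond_le hs0 hs1 h]
  have hm0 : 0 ≤ countBeyond t' e s := Nat.cast_nonneg _
  have hmn : countBeyond t' e s ≤ total n := by
    rw [hm]; exact Finset.sum_le_sum fun i _ => hle i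
  obtain ⟨b, hb⟩ : ∃ b, countBeyond t' e s = b * total n := ⟨_, (div_mul_cancel₀ _ hn.ne').symm⟩
  obtain ⟨w, hw⟩ : ∃ w, medianWeight z t e s = w * total n := ⟨_, (div_mul_cancel₀ _ hn.ne').symm⟩
  have hq : ∑ a, 2 * cutSep e s q (t' a) =
      if s < e.proj q then 2 * (total n - countBeyond t' e s) else 2 * countBeyond t' e s := by
    rw [← hcard]
    split_ifs with h
    · have := sum_ite_beyond t' e s 0 2
      rw [mul_zero, zero_add, mul_comm _ (2 : ℝ)] at this
      rw [← this]
      exact Finset.sum_congr rfl fun a _ => by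
        by_cases ha : s < e.proj (t' a) <;> simp [cutSep, h, ha]
    · have := sum_ite_beyond t' e s 2 0
      rw [mul_zero, add_zero, mul_comm _ (2 : ℝ)] at this
      rw [← this]
      exact Finset.sum_congr rfl fun a _ => by
        by_cases ha : s < e.proj (t' a) <;> simp [cutSep, h, ha]
  rw [hq, hb, hw, mul_div_cancel_right₀ _ hn.ne']
  rw [hb] at hW1 hW2 hm0 hmn
  rw [hw] at hW1 hW2
  have hb0 : 0 ≤ b := nonneg_of_mul_nonneg_left hm0 hn
  have hb1 : b ≤ 1 := by nlinarith
  have hw1 : w ≤ 2 * b := by nlinarith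
  have hw2 : 1 - w ≤ 2 * (1 - b) := by nlinarith
  have r1 := one_sub_two_mul_mul_ramp_le hb0 hw1
  -- Exchanging the sides of the cut gives the bound by `2(1 - b)`, needed when `q` is beyond.
  have r2 := one_sub_two_mul_mul_ramp_le (sub_nonneg.2 hb1) hw2
  rw [ramp_one_sub] at r2
  split_ifs with h
  · nlinarith
  · nlinarith

end TRM

end MetricTree

end

/-- On every finite metric tree, the Tree Randomized Mechanism is a well-defined randomized mechanism,
is two-sided incentive compatible, and is `2`-competitive. -/
theorem mainTheorem1 {V : Type*} [Fintype V] (T : MetricTree V) (z : T.Point)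
    {k : ℕ} (n : Fin k → ℕ) (hn : 0 < ∑ i, n i) :
    ∃ M : MetricTree.RandomizedMechanism T n,
      MetricTree.TRM.IsTRM z M ∧ MetricTree.TwoSidedIC M ∧ MetricTree.IsCompetitive 2 M := by
  have hn' : 0 < MetricTree.TRM.total n := by
    unfold MetricTree.TRM.total
    exact_mod_cast hn
  obtain ⟨M, hM⟩ := MetricTree.TRM.exists_isTRM z hn'
  exact ⟨M, hM, ⟨MetricTree.TRM.agentSideIC hn' hM, MetricTree.TRM.mediatorSideIC hn' hM⟩,
    MetricTree.TRM.isCompetitive hn' hM⟩
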